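/- **Model.** Let $r_\oplus,r_{\min},\alpha,p_s,p_i,\sigma^2>0$, let $N\ge1$ and let $K$ divide $N$. $N$ satellites are placed independently and uniformly on the sphere of radius $r_\oplus+r_{\min}$ centred at the centre of the Earth, and a user is at distance $r_\oplus$ from the centre. Each of $K$ channels is assigned to $N/K$ of the satellites, by a random assignment independent of the positions. A satellite is visible if its distance from the user is at most $r_{\max}=\sqrt{2r_\oplus r_{\min}+r_{\min}^2}$. Let $R_0$ be the distance to the nearest (serving) satellite, $F_{R_0}$ its distribution function, $N_I$ the number of other visible satellites on the channel of the serving satellite, $R_n$ their distances, and $I=\sum_{n=1}^{N_I}p_iG_nR_n^{-\alpha}$ the interference, where the fading gains $G_n$ are i.i.d., almost surely positive, of arbitrary law, and independent of the positions and of the channel assignment. The serving channel is non-fading: $\mathrm{SINR}=p_sG_0R_0^{-\alpha}/(I+\sigma^2)$ and $\mathrm{SNR}=p_sG_0R_0^{-\alpha}/\sigma^2$ with $G_0=1$ if $R_0\le r_{\max}$ and $G_0=0$ otherwise. Put $$P_0(r_0)=\left(1-\frac{r_{\min}-(r_0^2-r_{\min}^2)/(2r_\oplus)}{2(r_\oplus+r_{\min})-(r_0^2-r_{\min}^2)/(2r_\oplus)}\right)^{\frac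 NK-1}\ (r_0\le r_{\max}),\qquad P_0(r_0)=1\ (r_0>r_{\max}),$$ let $\mathcal L_I(s)=\mathcal L_I(s;r_0)=\mathbb E[e^{-sI}\mid R_0=r_0,\,N_I>0]$, let $T>0$ and $c=(p_s/(T\sigma^2))^{1/\alpha}$, and put $$J(r_0)=\int_{-\infty}^{\infty}\mathcal L_I(j\omega;r_0)\,\frac{e^{j\left(\frac{p_s}{Tr_0^\alpha}-\sigma^2\right)\omega}-1}{j\omega}\,d\omega ,$$ the integral being the limit of the integrals over $[-W,W]$ as $W\to\infty$. (If $\mathbb P(N_I>0\mid R_0=r_0)=0$, expressions conditioned on that event are read as $0$.) **Theorem 2.** $P_0(r_0)=\mathbb P(N_I=0\mid R_0=r_0)$ for almost every value $r_0$ of $R_0$. For almost every $r_0\in[r_{\min},r_{\max}]$ the limit $J(r_0)$ exists, $$\mathbb P(\mathrm{SINR}>T\mid R_0=r_0,N_I>0)=\frac1{2\pi}J(r_0),$$ $$\mathbb P(\mathrm{SINR}>T\mid R_0=r_0)=P_0(r_0)\,\mathbf 1(r_0<c)+(1-P_0(r_0))\,\frac1{2\pi}J(r_0).$$ Moreover $\mathbb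 P(\mathrm{SNR}>T)=F_{R_0}(\min(c,r_{\max}))$, which is $F_{R_0}\big((p_s/(T\sigma^2))^{1/\alpha}\big)$ when $c\le r_{\max}$; $$\int_{[r_{\min},r_{\max}]}\mathbb P(\mathrm{SINR}>T\mid R_0=r_0,N_I>0)\,dF_{R_0}(r_0)=\frac{N}{4\pi r_\oplus(r_\oplus+r_{\min})}\int_{r_{\min}}^{r_{\max}}J(r_0)\left(1-\frac{r_0^2-r_{\min}^2}{4r_\oplus(r_\oplus+r_{\min})}\right)^{N-1}r_0\,dr_0 ;$$ and the coverage probability is $$\mathbb P(\mathrm{SINR}>T)=\int_{r_0\le\min(c,r_{\max})}P_0(r_0)\,dF_{R_0}(r_0)+\frac{N}{4\pi r_\oplus(r_\oplus+r_{\min})}\int_{r_{\min}}^{r_{\max}}(1-P_0(r_0))\,J(r_0)\left(1-\frac{r_0^2-r_{\min}^2}{4r_\oplus(r_\oplus+r_{\min})}\right)^{N-1}r_0\,dr_0,$$ where the first term is $\mathbb P(\mathrm{SNR}>T,\,N_I=0)$ and the second is $\mathbb P(\mathrm{SINR}>T,\,N_I>0)$. The integrals over $r_0$ converge absolutely. 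-/

import Mathlib

open MeasureTheory ProbabilityTheory Filter Topology Set

namespace LEO

noncomputable section

/-- Three-dimensional Euclidean space. -/
abbrev E3 : Type := EuclideanSpace ℝ (Fin 3)

/-- The uniform probability distribution on the sphere of radius `ρ` centred at the origin:
the normalized surface measure of the unit sphere, scaled by `ρ`. -/
def uniformSphere (ρ : ℝ) : Measure E3 :=
  Measure.map (fun x : Metric.sphere (0 : E3) 1 => ρ • (x : E3))
    (((volume : Measure E3).toSphere univ)⁻¹ • (volume : Measure E3).toSphere)

/-- Deterministic parameters of the network: `N` satellites, `K` orthogonal channels with the same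
number `N / K` of satellites on each, Earth radius `rE`, altitude `rMin`, path loss exponent `α`,
transmission powers `pS` (serving) and `pI` (interfering), noise power `noise`
(that is, `σ²`). -/
structure Params where
  N : ℕ
  K : ℕ
  rE : ℝ
  rMin : ℝ
  α : ℝ
  pS : ℝ
  pI : ℝ
  noise : ℝ
  N_pos : 0 < N
  K_dvd : K ∣ N
  rE_pos : 0 < rE
  rMin_pos : 0 < rMin
  α_pos : 0 < α
  pS_pos : 0 < pS
  pI_pos : 0 < pI
  noise_pos : 0 < noise

namespace Params

variable (p : Params)

/-- The distance from a user to a satellite at the horizon. -/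
def rMax : ℝ := Real.sqrt (2 * p.rE * p.rMin + p.rMin ^ 2)

/-- `1 - (r² - rMin²) / (4 rE (rE + rMin))`, the probability that a uniformly placed satellite is
farther than `r` from the user. -/
def tail (r : ℝ) : ℝ := 1 - (r ^ 2 - p.rMin ^ 2) / (4 * p.rE * (p.rE + p.rMin))

/-- The success probability of the binomial number of interferers when the serving distance
is `r`. -/
def interfProb (r : ℝ) : ℝ :=
  (p.rMin - (r ^ 2 - p.rMin ^ 2) / (2 * p.rE)) /
    (2 * (p.rE + p.rMin) - (r ^ 2 - p.rMin ^ 2) / (2 * p.rE))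

/-- The probability `P₀` of no interference when the serving distance is `r`. -/
def P0 (r : ℝ) : ℝ :=
  if r ≤ p.rMax then (1 - p.interfProb r) ^ (p.N / p.K - 1) else 1

/-- The distance `(pS / (T σ²)) ^ (1 / α)` up to which the signal-to-noise ratio exceeds `T`. -/
def snrRange (T : ℝ) : ℝ := (p.pS / (T * p.noise)) ^ (1 / p.α)

end Params

/-- The random network. The satellites are independent and uniform on the sphere of radius
`rE + rMin`; the user is any point at distance `rE` from the centre. Every channel gets `N / K`
satellites, by a random assignment independent of everything else. The interfering
fading gains are i.i.d. and positive with an arbitrary law, and independent of the positions and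
of the assignment. -/
structure Network (p : Params) (Ω : Type*) [MeasurableSpace Ω] (P : Measure Ω) where
  user : E3
  pos : Fin p.N → Ω → E3
  gain : Fin p.N → Ω → ℝ
  chan : Ω → Fin p.N → Fin p.K
  user_norm : ‖user‖ = p.rE
  pos_meas : ∀ i, Measurable (pos i)
  gain_meas : ∀ i, Measurable (gain i)
  chan_meas : Measurable chan
  pos_law : ∀ i, P.map (pos i) = uniformSphere (p.rE + p.rMin)
  pos_indep : iIndepFun pos P
  gain_pos : ∀ i, ∀ᵐ w ∂P, 0 < gain i w
  gain_ident : ∀ i j, IdentDistrib (gain i) (gain j) P P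
  gain_indep : iIndepFun gain P
  chan_balanced : ∀ᵐ w ∂P, ∀ k, (Finset.univ.filter fun i => chan w i = k).card = p.N / p.K
  pos_indep_rest : IndepFun (fun w i => pos i w) (fun w => ((fun i => gain i w), chan w)) P
  gain_indep_chan : IndepFun (fun w i => gain i w) chan P

namespace Network

variable {p : Params} {Ω : Type*} [MeasurableSpace Ω] {P : Measure Ω} (M : Network p Ω P)

/-- Distance from the user to satellite `i`. -/
def R (i : Fin p.N) (w : Ω) : ℝ := dist M.user (M.pos i w)

/-- The set of nearest satellites (a single one almost surely). -/
def nearest (w : Ω) : Finset (Fin p.N) :=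
  open Classical in Finset.univ.filter fun i => ∀ j, M.R i w ≤ M.R j w

theorem nearest_nonempty (w : Ω) : (M.nearest w).Nonempty := by
  classical
  have : Nonempty (Fin p.N) := ⟨⟨0, p.N_pos⟩⟩
  obtain ⟨i, -, hi⟩ := Finset.exists_min_image Finset.univ (fun i => M.R i w)
    Finset.univ_nonempty
  exact ⟨i, Finset.mem_filter.2 ⟨Finset.mem_univ i, fun j => hi j (Finset.mem_univ j)⟩⟩

/-- The serving satellite: the nearest one. -/
def serving (w : Ω) : Fin p.N := (M.nearest w).min' (M.nearest_nonempty w)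

/-- The serving distance `R₀`. -/
def R0 (w : Ω) : ℝ := M.R (M.serving w) w

/-- The satellites other than the serving one which are on its channel and above the horizon. -/
def interferers (w : Ω) : Finset (Fin p.N) :=
  open Classical in Finset.univ.filter fun i =>
    i ≠ M.serving w ∧ M.chan w i = M.chan w (M.serving w) ∧ M.R i w ≤ p.rMax

/-- The number `N_I` of interfering satellites. -/
def NI (w : Ω) : ℕ := (M.interferers w).card

/-- The cumulative interference power `I`. -/
def I (w : Ω) : ℝ := ∑ i ∈ M.interferers w, p.pI * M.gain i w * M.R i w ^ (-p.α)

/-- Gain of the serving link: there is no fading, and a satellite below the horizon is not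
received. -/
def G0 (w : Ω) : ℝ := if M.R0 w ≤ p.rMax then 1 else 0

/-- Signal-to-interference-plus-noise ratio. -/
def SINR (w : Ω) : ℝ := p.pS * M.G0 w * M.R0 w ^ (-p.α) / (M.I w + p.noise)

/-- Signal-to-noise ratio. -/
def SNR (w : Ω) : ℝ := p.pS * M.G0 w * M.R0 w ^ (-p.α) / p.noise

/-- The coverage probability. -/
def coverage (T : ℝ) : ℝ := P.real {w | T < M.SINR w}

/-- The law of the serving distance. -/
def servingLaw : Measure ℝ := P.map M.R0

variable [IsProbabilityMeasure P]

/-- The regular conditional distribution of `(SINR, I, N_I)` given `R₀ = r`. -/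
def condKernel : Kernel ℝ (ℝ × ℝ × ℕ) :=
  condDistrib (fun w => (M.SINR w, M.I w, M.NI w)) M.R0 P

/-- The conditional distribution of `(SINR, I, N_I)` given `R₀ = r` and `N_I > 0`. -/
def condLaw (r : ℝ) : Measure (ℝ × ℝ × ℕ) := (M.condKernel r)[|{x | 0 < x.2.2}]

/-- `ℙ(N_I = 0 | R₀ = r)`. -/
def noInterf (r : ℝ) : ℝ := (M.condKernel r).real {x | x.2.2 = 0}

/-- `ℙ(SINR > T | R₀ = r)`. -/
def condCoverage (T r : ℝ) : ℝ := (M.condKernel r).real {x | T < x.1}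

/-- `ℙ(SINR > T | R₀ = r, N_I > 0)`. -/
def condCoverageInterf (T r : ℝ) : ℝ := (M.condLaw r).real {x | T < x.1}

/-- The Laplace transform `s ↦ 𝔼[exp (-s I) | R₀ = r, N_I > 0]` of the interference when the serving
distance is `r` and there is interference. -/
def laplaceI (r : ℝ) (s : ℂ) : ℂ := ∫ x, Complex.exp (-s * (x.2.1 : ℂ)) ∂(M.condLaw r)

/-- The integrand `L_I(jω) (exp (j (pS / (T r ^ α) - σ²) ω) - 1) / (jω)`. -/
def freqIntegrand (T r ω : ℝ) : ℂ :=
  M.laplaceI r (Complex.I * ω) *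
    ((Complex.exp (Complex.I * ((p.pS / (T * r ^ p.α) - p.noise : ℝ) : ℂ) * ω) - 1) /
      (Complex.I * ω))

end Network

/-- `∫_{-∞}^{∞} f(ω) dω` converges, as the limit of the integrals over `[-W, W]`, to `a`. -/
def HasPVIntegral (f : ℝ → ℂ) (a : ℂ) : Prop :=
  (∀ W : ℝ, IntervalIntegrable f volume (-W) W) ∧
    Tendsto (fun W : ℝ => ∫ ω in (-W)..W, f ω) atTop (𝓝 a)

end

end LEO

namespace LEO

noncomputable section

/-! ### The hat-box theorem of Archimedes -/

/-! The proof has two independent ingredients: the joint law of the serving distance and the event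
of no interference, and an inversion formula for the distribution function of the interference.

Geometry. By Archimedes, the height of a uniform point of a sphere along any axis is uniform. The
squared distance from the user to a satellite is an affine function of that height, so a satellite
is farther than `r` with probability `tail r`, and its distance has an atomless law
(`map_dist_uniformSphere`). The distances are i.i.d. and independent of channels and gains. With
distances almost surely distinct, one fixes which satellite serves and its distance `r`; the others
must then be beyond `r`, and those on its channel beyond the horizon too if there is to be no
interference. The product of these tail probabilities gives the serving density and `P0` together
(`measure_R0_mem_NI_eq_zero`).

Inversion. For `y > 0`, the symmetric frequency integral of `exp (-jωy) (exp (jaω) - 1) / (jω)` over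
`[-W, W]` is a sum of two sine integrals. By the Dirichlet integral it tends to `2π` if `y < a` and
to `0` if `y > a`, and it is bounded uniformly in `W`. Fubini and dominated convergence give `2π μ
{Y < a}` for a positive `Y` that almost surely avoids `a` (`hasPVIntegral_inversion`). When there is
interference, `SINR > T` says that `I` is below `margin T r`. The exceptional value has probability
zero whatever the law of the gains, because the distance of one interferer already makes `I`
atomless (`ae_interference_ne`).

Conditioning. The almost sure facts about the network pass to the conditional laws given the serving
distance, where inversion is applied for almost every `r`. Splitting according to whether there is
interference, and integrating against the serving density, gives the remaining formulas. -/

theorem volume_disc (c : ℝ) :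
    volume {z : Fin 2 → ℝ | z 0 ^ 2 + z 1 ^ 2 < c} = ENNReal.ofReal (Real.pi * c) := by
  have hpre : {z : Fin 2 → ℝ | z 0 ^ 2 + z 1 ^ 2 < c} =
      (WithLp.toLp 2) ⁻¹' (Metric.ball (0 : EuclideanSpace ℝ (Fin 2)) (Real.sqrt c)) := by
    ext z
    simp only [mem_ofPred_eq, mem_preimage, mem_ball_zero_iff, EuclideanSpace.norm_eq,
      Fin.sum_univ_two, Real.norm_eq_abs, sq_abs]
    rw [Real.sqrt_lt_sqrt_iff (by positivity)]
  rw [hpre, (PiLp.volume_preserving_toLp (Fin 2)).measure_preimage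
    Metric.isOpen_ball.measurableSet.nullMeasurableSet, EuclideanSpace.volume_ball_fin_two]
  rcases le_total c 0 with hc | hc
  · rw [Real.sqrt_eq_zero_of_nonpos hc, ENNReal.ofReal_of_nonpos
      (mul_nonpos_of_nonneg_of_nonpos Real.pi_pos.le hc)]
    simp
  · rw [← ENNReal.ofReal_pow (Real.sqrt_nonneg _), Real.sq_sqrt hc,
      ← ENNReal.ofReal_mul hc, mul_comm]

/-- The minimum switches at `s = t`: below that height the cone bounds the slice, above it the ball
does. -/
theorem integral_min_cone {t : ℝ} (ht0 : 0 < t) (ht1 : t < 1) :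
    ∫ s in (0 : ℝ)..1, Real.pi * min (1 - s ^ 2) (s ^ 2 * (1 / t ^ 2 - 1)) =
      2 * Real.pi / 3 * (1 - t) := by
  have hcont : Continuous fun s : ℝ => Real.pi * min (1 - s ^ 2) (s ^ 2 * (1 / t ^ 2 - 1)) := by
    fun_prop
  rw [← intervalIntegral.integral_add_adjacent_intervals (hcont.intervalIntegrable 0 t)
    (hcont.intervalIntegrable t 1)]
  have h1 : ∫ s in (0 : ℝ)..t, Real.pi * min (1 - s ^ 2) (s ^ 2 * (1 / t ^ 2 - 1)) =
      ∫ s in (0 : ℝ)..t, Real.pi * (s ^ 2 * (1 / t ^ 2 - 1)) := by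
    refine intervalIntegral.integral_congr fun s hs => ?_
    rw [uIcc_of_le ht0.le] at hs
    have : s ^ 2 * (1 / t ^ 2) ≤ 1 := by
      rw [mul_one_div, div_le_one (by positivity)]
      exact pow_le_pow_left₀ hs.1 hs.2 2
    rw [min_eq_right (by linarith)]
  have h2 : ∫ s in t..1, Real.pi * min (1 - s ^ 2) (s ^ 2 * (1 / t ^ 2 - 1)) =
      ∫ s in t..1, Real.pi * (1 - s ^ 2) := by
    refine intervalIntegral.integral_congr fun s hs => ?_
    rw [uIcc_of_le ht1.le] at hs
    have : 1 ≤ s ^ 2 * (1 / t ^ 2) := by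
      rw [mul_one_div, one_le_div (by positivity)]
      exact pow_le_pow_left₀ ht0.le hs.1 2
    rw [min_eq_left (by linarith)]
  rw [h1, h2, intervalIntegral.integral_const_mul, intervalIntegral.integral_const_mul,
    intervalIntegral.integral_mul_const, intervalIntegral.integral_sub (by simp) (by simp)]
  simp only [integral_pow, intervalIntegral.integral_const, smul_eq_mul]
  field_simp
  ring

/-- Cavalieri along the axis: the slice at height `s` is a disc, cut out either by the ball or by
the cone, and `volume_disc` gives its area. -/
theorem volume_cone_coord {t : ℝ} (ht0 : 0 < t) (ht1 : t < 1) :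
    volume {y : E3 | ‖y‖ < 1 ∧ t * ‖y‖ < y 0} = ENNReal.ofReal (2 * Real.pi / 3 * (1 - t)) := by
  let S : Set (ℝ × (Fin 2 → ℝ)) := {q | 0 < q.1 ∧
    q.2 0 ^ 2 + q.2 1 ^ 2 < min (1 - q.1 ^ 2) (q.1 ^ 2 * (1 / t ^ 2 - 1))}
  have hS : MeasurableSet S := by
    simp only [S, ofPred_and]
    exact (measurableSet_lt (by fun_prop) (by fun_prop)).inter
      (measurableSet_lt (by fun_prop) (by fun_prop))
  have hmp := (volume_preserving_piFinSuccAbove (fun _ : Fin 3 => ℝ) 0).comp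
    (EuclideanSpace.volume_preserving_symm_measurableEquiv_toLp (Fin 3))
  have hpre : {y : E3 | ‖y‖ < 1 ∧ t * ‖y‖ < y 0} =
      (⇑(MeasurableEquiv.piFinSuccAbove (fun _ : Fin 3 => ℝ) 0) ∘
        ⇑(MeasurableEquiv.toLp 2 (Fin 3 → ℝ)).symm) ⁻¹' S := by
    ext y
    have hnorm : ‖y‖ ^ 2 = y 0 ^ 2 + (y 1 ^ 2 + y 2 ^ 2) := by
      rw [EuclideanSpace.norm_sq_eq, Fin.sum_univ_three]
      simp [add_assoc]
    have hn := norm_nonneg y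
    have key : (‖y‖ < 1 ∧ t * ‖y‖ < y 0) ↔ (0 < y 0 ∧
        y 1 ^ 2 + y 2 ^ 2 < min (1 - y 0 ^ 2) (y 0 ^ 2 * (1 / t ^ 2 - 1))) := by
      rw [lt_min_iff, mul_sub, mul_one_div, mul_one, lt_sub_iff_add_lt, lt_sub_iff_add_lt,
        add_comm (y 1 ^ 2 + y 2 ^ 2), ← hnorm, lt_div_iff₀ (by positivity)]
      constructor
      · rintro ⟨h1, h2⟩
        have h0 : 0 ≤ t * ‖y‖ := by positivity
        refine ⟨h0.trans_lt h2, by nlinarith, ?_⟩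
        nlinarith
      · rintro ⟨h1, h2, h3⟩
        refine ⟨by nlinarith, ?_⟩
        refine lt_of_pow_lt_pow_left₀ 2 h1.le ?_
        rw [mul_pow]; linarith
    exact key
  rw [hpre, hmp.measure_preimage hS.nullMeasurableSet, Measure.volume_eq_prod,
    Measure.prod_apply hS]
  have hslice : ∀ s : ℝ, volume (Prod.mk s ⁻¹' S) = (Ioc (0 : ℝ) 1).indicator
      (fun s => ENNReal.ofReal (Real.pi * min (1 - s ^ 2) (s ^ 2 * (1 / t ^ 2 - 1)))) s := by
    intro s
    by_cases hs : 0 < s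
    · have : Prod.mk s ⁻¹' S = {z : Fin 2 → ℝ | z 0 ^ 2 + z 1 ^ 2 <
          min (1 - s ^ 2) (s ^ 2 * (1 / t ^ 2 - 1))} := by
        ext z; simp [S, hs]
      rw [this, volume_disc]
      by_cases hs1 : s ≤ 1
      · rw [indicator_of_mem (show s ∈ Ioc (0 : ℝ) 1 from ⟨hs, hs1⟩)]
      · rw [indicator_of_notMem (fun h => hs1 h.2), ENNReal.ofReal_eq_zero]
        refine mul_nonpos_of_nonneg_of_nonpos Real.pi_pos.le ((min_le_left _ _).trans ?_)
        nlinarith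
    · rw [indicator_of_notMem (fun h => hs h.1)]
      have : Prod.mk s ⁻¹' S = ∅ := by
        ext z; simp [S, hs]
      rw [this, measure_empty]
  simp_rw [hslice]
  rw [lintegral_indicator measurableSet_Ioc, ← integral_min_cone ht0 ht1,
    intervalIntegral.integral_of_le zero_le_one, ofReal_integral_eq_lintegral_ofReal]
  · have hcont : Continuous fun s : ℝ =>
        Real.pi * min (1 - s ^ 2) (s ^ 2 * (1 / t ^ 2 - 1)) := by fun_prop
    exact (hcont.intervalIntegrable 0 1).1
  · filter_upwards [ae_restrict_mem measurableSet_Ioc] with s hs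
    have h1 : 1 ≤ 1 / t ^ 2 := by
      rw [one_le_div (by positivity)]; nlinarith
    have h2 : 0 ≤ s ^ 2 * (1 / t ^ 2 - 1) := mul_nonneg (sq_nonneg s) (by linarith)
    have h3 : 0 ≤ 1 - s ^ 2 := by nlinarith [hs.1, hs.2]
    exact mul_nonneg Real.pi_pos.le (le_min h3 h2)

/-- Rotation invariance: `u` is completed to an orthonormal basis, whose coordinate map preserves
volume. -/
theorem volume_cone {u : E3} (hu : ‖u‖ = 1) {t : ℝ} (ht0 : 0 < t) (ht1 : t < 1) :
    volume {y : E3 | ‖y‖ < 1 ∧ t * ‖y‖ < inner ℝ u y} =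
      ENNReal.ofReal (2 * Real.pi / 3 * (1 - t)) := by
  have horth : Orthonormal ℝ (({0} : Set (Fin 3)).domRestrict fun _ => u) := by
    constructor
    · intro i; simpa using hu
    · intro i j hij; exact absurd (Subsingleton.elim i j) hij
  obtain ⟨b, hb⟩ := horth.exists_orthonormalBasis_extension_of_card_eq (by simp)
  have hb0 : b 0 = u := hb 0 rfl
  have hmeas : MeasurableSet {y : E3 | ‖y‖ < 1 ∧ t * ‖y‖ < y 0} := by
    rw [ofPred_and]
    exact (measurableSet_lt (by fun_prop) (by fun_prop)).inter
      (measurableSet_lt (by fun_prop) (by fun_prop))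
  rw [← volume_cone_coord ht0 ht1, ← b.measurePreserving_repr.measure_preimage
    hmeas.nullMeasurableSet]
  congr 1
  ext y
  simp only [mem_ofPred_eq, mem_preimage, LinearIsometryEquiv.norm_map, b.repr_apply_apply, hb0]

open scoped Pointwise in
-- The surface measure of a set is the dimension times the volume of the solid cone over it, so the
-- cap is reduced to `volume_cone`.
theorem toSphere_cap {u : E3} (hu : ‖u‖ = 1) {t : ℝ} (ht0 : 0 < t) (ht1 : t < 1) :
    (volume : Measure E3).toSphere {x | t < inner ℝ u (x : E3)} =
      ENNReal.ofReal (2 * Real.pi * (1 - t)) := by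
  have hmeas : MeasurableSet {x : Metric.sphere (0 : E3) 1 | t < inner ℝ u (x : E3)} :=
    measurableSet_lt measurable_const (by fun_prop)
  have hset : Ioo (0 : ℝ) 1 • (Subtype.val '' {x : Metric.sphere (0 : E3) 1 | t < inner ℝ u (x : E3)}) =
      {y : E3 | ‖y‖ < 1 ∧ t * ‖y‖ < inner ℝ u y} := by
    ext y
    simp only [Set.mem_smul, mem_image, mem_ofPred_eq]
    constructor
    · rintro ⟨a, ha, _, ⟨x, hx, rfl⟩, rfl⟩
      have hx1 : ‖(x : E3)‖ = 1 := mem_sphere_zero_iff_norm.1 x.2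
      rw [norm_smul, hx1, Real.norm_of_nonneg ha.1.le, mul_one, inner_smul_right]
      exact ⟨ha.2, by nlinarith [ha.1]⟩
    · rintro ⟨h1, h2⟩
      have hy : y ≠ 0 := by
        rintro rfl; simp at h2
      have hpos : 0 < ‖y‖ := norm_pos_iff.2 hy
      refine ⟨‖y‖, ⟨hpos, h1⟩, ‖y‖⁻¹ • y, ⟨⟨‖y‖⁻¹ • y, ?_⟩, ?_, rfl⟩, ?_⟩
      · simp [norm_smul, hpos.ne']
      · simp only [inner_smul_right]
        rw [inv_mul_eq_div, lt_div_iff₀ hpos]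
        exact h2
      · rw [smul_smul, mul_inv_cancel₀ hpos.ne', one_smul]
  rw [Measure.toSphere_apply' _ hmeas, hset, volume_cone hu ht0 ht1]
  have : ((Module.finrank ℝ E3 : ℕ) : ENNReal) = ENNReal.ofReal 3 := by simp
  rw [this, ← ENNReal.ofReal_mul (by norm_num)]
  congr 1; ring

theorem toSphere_univ : (volume : Measure E3).toSphere univ = ENNReal.ofReal (4 * Real.pi) := by
  rw [Measure.toSphere_apply_univ, EuclideanSpace.volume_ball_fin_three]
  have : ((Module.finrank ℝ E3 : ℕ) : ENNReal) = ENNReal.ofReal 3 := by simp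
  rw [this]
  simp only [ENNReal.ofReal_one, one_pow, one_mul]
  rw [← ENNReal.ofReal_mul (by norm_num)]
  congr 1; ring

/-- The uniform probability distribution on the unit sphere. -/
def unitSphereLaw : Measure (Metric.sphere (0 : E3) 1) :=
  ((volume : Measure E3).toSphere univ)⁻¹ • (volume : Measure E3).toSphere

instance : IsProbabilityMeasure unitSphereLaw := by
  refine ⟨?_⟩
  rw [unitSphereLaw, Measure.smul_apply, smul_eq_mul]
  refine ENNReal.inv_mul_cancel ?_ (measure_ne_top _ _)
  rw [toSphere_univ]
  exact (ENNReal.ofReal_pos.2 (by positivity)).ne'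

theorem unitSphereLaw_cap {u : E3} (hu : ‖u‖ = 1) {t : ℝ} (ht0 : 0 < t) (ht1 : t < 1) :
    unitSphereLaw.real {x | t < inner ℝ u (x : E3)} = (1 - t) / 2 := by
  have hpi := Real.pi_pos
  rw [measureReal_def, unitSphereLaw, Measure.smul_apply, smul_eq_mul, toSphere_cap hu ht0 ht1,
    toSphere_univ, ENNReal.toReal_mul, ENNReal.toReal_inv, ENNReal.toReal_ofReal (by positivity),
    ENNReal.toReal_ofReal (mul_nonneg (by positivity) (by linarith))]
  field_simp
  norm_num

/-- The height of a uniform point of the unit sphere is uniformly distributed on `[-1, 1]`. -/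
theorem unitSphereLaw_inner_le {u : E3} (hu : ‖u‖ = 1) {t : ℝ} (ht : -1 ≤ t) (ht1 : t ≤ 1) :
    unitSphereLaw.real {x | inner ℝ u (x : E3) ≤ t} = (1 + t) / 2 := by
  have hpos : ∀ s : ℝ, 0 < s → s < 1 →
      unitSphereLaw.real {x | inner ℝ u (x : E3) ≤ s} = (1 + s) / 2 := by
    intro s h0 h1
    have hmeas : MeasurableSet {x : Metric.sphere (0 : E3) 1 | s < inner ℝ u (x : E3)} :=
      measurableSet_lt measurable_const (by fun_prop)
    have hc : {x : Metric.sphere (0 : E3) 1 | inner ℝ u (x : E3) ≤ s} =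
        {x : Metric.sphere (0 : E3) 1 | s < inner ℝ u (x : E3)}ᶜ := by ext; simp
    rw [hc, probReal_compl_eq_one_sub hmeas, unitSphereLaw_cap hu h0 h1]
    ring
  have hneg : ∀ s : ℝ, -1 < s → s < 0 →
      unitSphereLaw.real {x | inner ℝ u (x : E3) < s} = (1 + s) / 2 := by
    intro s h0 h1
    have h := unitSphereLaw_cap (u := -u) (by simpa using hu) (t := -s) (by linarith) (by linarith)
    simpa [inner_neg_left] using h
  have hmono : ∀ {A B : Set (Metric.sphere (0 : E3) 1)}, A ⊆ B →
      unitSphereLaw.real A ≤ unitSphereLaw.real B := fun h => measureReal_mono h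
  have hupper : ∀ s, t < s → s ≠ 0 →
      unitSphereLaw.real {x | inner ℝ u (x : E3) ≤ t} ≤ (1 + s) / 2 := by
    intro s hs h0
    rcases lt_or_ge s 1 with h1 | h1
    · rcases h0.lt_or_gt with h | h
      · rw [← hneg s (by linarith) h]
        exact hmono fun x (hx : _ ≤ t) => hx.trans_lt hs
      · rw [← hpos s h h1]
        exact hmono fun x (hx : _ ≤ t) => hx.trans hs.le
    · exact measureReal_le_one.trans (by linarith)
  have hlower : ∀ s, s < t → s ≠ 0 →
      (1 + s) / 2 ≤ unitSphereLaw.real {x | inner ℝ u (x : E3) ≤ t} := by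
    intro s hs h0
    rcases lt_or_ge (-1) s with h1 | h1
    · rcases h0.lt_or_gt with h | h
      · rw [← hneg s h1 h]
        exact hmono fun x (hx : _ < s) => hx.le.trans hs.le
      · rw [← hpos s h (by linarith)]
        exact hmono fun x (hx : _ ≤ s) => hx.trans hs.le
    · exact le_trans (by linarith) measureReal_nonneg
  -- The cap formula and its reflection cover only nonzero heights strictly inside the interval. The
  -- values `-1`, `0`, `1` follow by squeezing between nearby nonzero heights.
  apply le_antisymm
  · refine le_of_forall_pos_lt_add fun ε hε => ?_
    obtain ⟨s, hs, hs0⟩ := ((Ioo_infinite (show t < t + ε by linarith)).sdiff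
      (finite_singleton (0 : ℝ))).nonempty
    linarith [hupper s hs.1 hs0, hs.2]
  · refine le_of_forall_pos_lt_add fun ε hε => ?_
    obtain ⟨s, hs, hs0⟩ := ((Ioo_infinite (show t - ε < t by linarith)).sdiff
      (finite_singleton (0 : ℝ))).nonempty
    linarith [hlower s hs.2 hs0, hs.1]

theorem uniformSphere_eq (ρ : ℝ) :
    uniformSphere ρ = unitSphereLaw.map fun x : Metric.sphere (0 : E3) 1 => ρ • (x : E3) := rfl

/-! ### The distance from the user to a satellite -/

namespace Params

variable (p : Params)

/-- The largest possible distance from the user to a satellite. -/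
def rFar : ℝ := 2 * p.rE + p.rMin

/-- The law of the distance from the user to a uniformly placed satellite. -/
def distLaw : Measure ℝ :=
  (volume.restrict (Icc p.rMin p.rFar)).withDensity
    fun r => ENNReal.ofReal (r / (2 * p.rE * (p.rE + p.rMin)))

theorem rMin_lt_rFar : p.rMin < p.rFar := by
  have := p.rE_pos; rw [rFar]; linarith

theorem tail_rMin : p.tail p.rMin = 1 := by simp [tail]

theorem tail_rFar : p.tail p.rFar = 0 := by
  have h1 := p.rE_pos
  have h2 := p.rMin_pos
  rw [tail, rFar]; field_simp; ring

theorem continuous_tail : Continuous p.tail := by unfold tail; fun_prop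

theorem tail_anti {r s : ℝ} (hr : 0 ≤ r) (hrs : r ≤ s) : p.tail s ≤ p.tail r := by
  have h1 := p.rE_pos
  have h2 := p.rMin_pos
  unfold tail
  gcongr

theorem tail_nonneg {r : ℝ} (hr0 : 0 ≤ r) (hr : r ≤ p.rFar) : 0 ≤ p.tail r :=
  p.tail_rFar ▸ p.tail_anti hr0 hr

theorem tail_pos {r : ℝ} (hr0 : 0 ≤ r) (hr : r < p.rFar) : 0 < p.tail r := by
  rw [← p.tail_rFar]
  have h1 := p.rE_pos
  have h2 := p.rMin_pos
  unfold tail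
  gcongr

theorem tail_le_one {r : ℝ} (hr : p.rMin ≤ r) : p.tail r ≤ 1 :=
  p.tail_rMin ▸ p.tail_anti p.rMin_pos.le hr

theorem distLaw_Iic_of_mem {r : ℝ} (hr : r ∈ Icc p.rMin p.rFar) :
    p.distLaw (Iic r) = ENNReal.ofReal (1 - p.tail r) := by
  have h1 := p.rE_pos
  have h2 := p.rMin_pos
  rw [distLaw, withDensity_apply _ measurableSet_Iic, Measure.restrict_restrict measurableSet_Iic]
  have hset : Iic r ∩ Icc p.rMin p.rFar = Icc p.rMin r := by
    ext x; simp only [mem_inter_iff, mem_Iic, mem_Icc]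
    exact ⟨fun h => ⟨h.2.1, h.1⟩, fun h => ⟨h.2, h.1, h.2.trans hr.2⟩⟩
  rw [hset, Measure.restrict_congr_set Ioc_ae_eq_Icc.symm, ← ofReal_integral_eq_lintegral_ofReal,
    ← intervalIntegral.integral_of_le hr.1, intervalIntegral.integral_div, integral_id]
  · congr 1
    unfold tail
    field_simp
    ring
  · exact ((continuous_id.div_const _).intervalIntegrable p.rMin r).1
  · filter_upwards [ae_restrict_mem measurableSet_Ioc] with x hx
    have : 0 < x := h2.trans hx.1
    simp only [Pi.zero_apply]
    positivity

theorem distLaw_Iic_of_lt {r : ℝ} (hr : r < p.rMin) : p.distLaw (Iic r) = 0 := by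
  rw [distLaw, withDensity_apply _ measurableSet_Iic, Measure.restrict_restrict measurableSet_Iic]
  have hset : Iic r ∩ Icc p.rMin p.rFar = ∅ := by
    ext x; simp only [mem_inter_iff, mem_Iic, mem_Icc, mem_empty_iff_false, iff_false]
    rintro ⟨h, h', -⟩; linarith
  simp [hset]

theorem distLaw_Iic_of_ge {r : ℝ} (hr : p.rFar ≤ r) : p.distLaw (Iic r) = 1 := by
  have : p.distLaw (Iic r) = p.distLaw (Iic p.rFar) := by
    rw [distLaw, withDensity_apply _ measurableSet_Iic, withDensity_apply _ measurableSet_Iic,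
      Measure.restrict_restrict measurableSet_Iic, Measure.restrict_restrict measurableSet_Iic]
    congr 2
    ext x; simp only [mem_inter_iff, mem_Iic, mem_Icc]
    exact ⟨fun h => ⟨h.2.2, h.2⟩, fun h => ⟨h.1.trans hr, h.2⟩⟩
  rw [this, p.distLaw_Iic_of_mem ⟨p.rMin_lt_rFar.le, le_rfl⟩, tail_rFar]
  simp

end Params

/-- By the law of cosines the squared distance is affine in the height of the satellite, which is
uniform on `[-1, 1]`; the distribution functions are then compared. -/
theorem map_dist_uniformSphere (p : Params) {user : E3} (hu : ‖user‖ = p.rE) :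
    (uniformSphere (p.rE + p.rMin)).map (fun x => dist user x) = p.distLaw := by
  have h1 := p.rE_pos
  have h2 := p.rMin_pos
  have hρ : 0 < p.rE + p.rMin := by positivity
  have hmeas : Measurable fun x : Metric.sphere (0 : E3) 1 => (p.rE + p.rMin) • (x : E3) := by
    fun_prop
  have hmeas' : Measurable fun x : E3 => dist user x := by fun_prop
  rw [uniformSphere_eq, Measure.map_map hmeas' hmeas]
  have hprob : IsProbabilityMeasure
      (unitSphereLaw.map ((fun x => dist user x) ∘ fun x : Metric.sphere (0 : E3) 1 => (p.rE + p.rMin) • (x : E3))) :=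
    Measure.isProbabilityMeasure_map (hmeas'.comp hmeas).aemeasurable
  -- The axis points away from the user, so that the distance increases with the height.
  set u : E3 := -(p.rE⁻¹ • user) with hudef
  have hu1 : ‖u‖ = 1 := by
    rw [hudef, norm_neg, norm_smul, hu, Real.norm_of_nonneg (by positivity),
      inv_mul_cancel₀ h1.ne']
  have hdist : ∀ x : Metric.sphere (0 : E3) 1, dist user ((p.rE + p.rMin) • (x : E3)) ^ 2 =
      p.rE ^ 2 + (p.rE + p.rMin) ^ 2 + 2 * (p.rE + p.rMin) * p.rE * inner ℝ u (x : E3) := by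
    intro x
    have hx1 : ‖(x : E3)‖ = 1 := mem_sphere_zero_iff_norm.1 x.2
    rw [dist_eq_norm, norm_sub_sq_real, hu, norm_smul, hx1, Real.norm_of_nonneg hρ.le,
      inner_smul_right, hudef, inner_neg_left, inner_smul_left]
    simp only [conj_trivial]
    field_simp
    ring
  have hin : ∀ x : Metric.sphere (0 : E3) 1, |inner ℝ u (x : E3)| ≤ 1 := by
    intro x
    have hx1 : ‖(x : E3)‖ = 1 := mem_sphere_zero_iff_norm.1 x.2
    simpa [hu1, hx1] using abs_real_inner_le_norm u (x : E3)
  refine Measure.ext_of_Iic _ _ fun r => ?_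
  rw [Measure.map_apply (hmeas'.comp hmeas) measurableSet_Iic]
  have hmin : ∀ x : Metric.sphere (0 : E3) 1,
      p.rMin ≤ dist user ((p.rE + p.rMin) • (x : E3)) := by
    intro x
    refine (sq_le_sq₀ h2.le dist_nonneg).1 ?_
    rw [hdist]
    have := (abs_le.1 (hin x)).1
    nlinarith [mul_pos hρ h1]
  have hmax : ∀ x : Metric.sphere (0 : E3) 1,
      dist user ((p.rE + p.rMin) • (x : E3)) ≤ p.rFar := by
    intro x
    have hF : 0 ≤ p.rFar := by rw [Params.rFar]; positivity
    refine (sq_le_sq₀ dist_nonneg hF).1 ?_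
    rw [hdist, Params.rFar]
    have := (abs_le.1 (hin x)).2
    nlinarith [mul_pos hρ h1]
  rcases lt_or_ge r p.rMin with hr | hr
  · rw [p.distLaw_Iic_of_lt hr]
    refine measure_mono_null (t := ∅) (fun x hx => ?_) measure_empty
    exact absurd (hmin x) (not_le.2 (lt_of_le_of_lt hx hr))
  rcases le_or_gt p.rFar r with hr' | hr'
  · rw [p.distLaw_Iic_of_ge hr']
    rw [← measure_univ (μ := unitSphereLaw)]
    congr 1
    exact eq_univ_of_forall fun x => (hmax x).trans hr'
  rw [p.distLaw_Iic_of_mem ⟨hr, hr'.le⟩]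
  have hr0 : 0 ≤ r := h2.le.trans hr
  set t : ℝ := (r ^ 2 - p.rE ^ 2 - (p.rE + p.rMin) ^ 2) / (2 * (p.rE + p.rMin) * p.rE) with ht
  have hset : ((fun x => dist user x) ∘ fun x : Metric.sphere (0 : E3) 1 =>
      (p.rE + p.rMin) • (x : E3)) ⁻¹' Iic r =
      {x : Metric.sphere (0 : E3) 1 | inner ℝ u (x : E3) ≤ t} := by
    ext x
    simp only [mem_preimage, Function.comp_apply, mem_Iic, mem_ofPred_eq]
    rw [← sq_le_sq₀ dist_nonneg hr0, hdist, ht, le_div_iff₀ (by positivity)]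
    constructor <;> intro h <;> linarith
  rw [hset, ← ofReal_measureReal, unitSphereLaw_inner_le hu1]
  · congr 1
    rw [ht, Params.tail]
    field_simp
    ring
  · rw [ht, le_div_iff₀ (by positivity)]
    nlinarith
  · rw [ht, div_le_one (by positivity)]
    have : r ^ 2 ≤ p.rFar ^ 2 := pow_le_pow_left₀ hr0 hr'.le 2
    rw [Params.rFar] at this
    nlinarith

namespace Params

variable (p : Params)

instance : IsProbabilityMeasure p.distLaw := by
  refine ⟨?_⟩
  have h : p.distLaw univ = p.distLaw (Iic p.rFar) := by
    rw [distLaw, withDensity_apply _ .univ, withDensity_apply _ measurableSet_Iic,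
      Measure.restrict_restrict measurableSet_Iic, Measure.restrict_univ]
    congr 2
    ext x; simp only [mem_inter_iff, mem_Iic, mem_Icc]
    exact ⟨fun h => ⟨h.2, h⟩, fun h => h.2⟩
  rw [h, p.distLaw_Iic_of_ge le_rfl]

instance : NullSingletonClass p.distLaw := by unfold distLaw; infer_instance

theorem distLaw_Ioi {r : ℝ} (hr : r ∈ Icc p.rMin p.rFar) :
    p.distLaw (Ioi r) = ENNReal.ofReal (p.tail r) := by
  have h := p.distLaw_Iic_of_mem hr
  rw [← compl_Iic, prob_compl_eq_one_sub measurableSet_Iic, h, ← ENNReal.ofReal_one,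
    ← ENNReal.ofReal_sub _ (by linarith [p.tail_le_one hr.1])]
  congr 1; ring

theorem ae_distLaw_mem : ∀ᵐ r ∂p.distLaw, r ∈ Icc p.rMin p.rFar :=
  (withDensity_absolutelyContinuous _ _).ae_le (ae_restrict_mem measurableSet_Icc)

end Params

end

end LEO

namespace LEO

noncomputable section

/-! ### The Dirichlet integral -/

theorem integral_exp_neg_mul_sin (t W : ℝ) :
    ∫ x in (0 : ℝ)..W, Real.exp (-(x * t)) * Real.sin x =
      (1 - Real.exp (-(W * t)) * (Real.cos W + t * Real.sin W)) / (1 + t ^ 2) := by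
  have ht : 1 + t ^ 2 ≠ 0 := by positivity
  have hderiv : ∀ x : ℝ, HasDerivAt
      (fun x => -(Real.exp (-(x * t)) * (Real.cos x + t * Real.sin x)) / (1 + t ^ 2))
      (Real.exp (-(x * t)) * Real.sin x) x := by
    intro x
    have h1 : HasDerivAt (fun x => Real.exp (-(x * t))) (Real.exp (-(x * t)) * (-(1 * t))) x :=
      (((hasDerivAt_id x).mul_const t).neg).exp
    have h2 : HasDerivAt (fun x => Real.cos x + t * Real.sin x)
        (-Real.sin x + t * Real.cos x) x :=
      (Real.hasDerivAt_cos x).add ((Real.hasDerivAt_sin x).const_mul t)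
    refine (((h1.mul h2).neg).div_const (1 + t ^ 2)).congr_deriv ?_
    field_simp
    ring
  rw [intervalIntegral.integral_eq_sub_of_hasDerivAt (fun x _ => hderiv x)
    ((by fun_prop : Continuous fun x : ℝ =>
      Real.exp (-(x * t)) * Real.sin x).intervalIntegrable _ _)]
  simp
  ring

/-- Cauchy–Schwarz gives the square root of the right side; the cruder bound is the one that cancels
the denominator `1 + t ^ 2`. -/
theorem abs_cos_add_mul_sin_le (t W : ℝ) : |Real.cos W + t * Real.sin W| ≤ 1 + t ^ 2 := by
  have h1 : (Real.cos W + t * Real.sin W) ^ 2 ≤ 1 + t ^ 2 := by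
    nlinarith [sq_nonneg (Real.sin W - t * Real.cos W), Real.sin_sq_add_cos_sq W]
  refine abs_le_of_sq_le_sq (h1.trans ?_) (by positivity)
  nlinarith [sq_nonneg t]

theorem integrableOn_exp_neg_mul {x : ℝ} (hx : 0 < x) :
    IntegrableOn (fun t : ℝ => Real.exp (-(x * t))) (Ioi 0) := by
  simpa using integrableOn_exp_mul_Ioi (neg_lt_zero.2 hx) 0

theorem integral_Ioi_exp_neg_mul {x : ℝ} (hx : 0 < x) :
    ∫ t in Ioi (0 : ℝ), Real.exp (-(x * t)) = 1 / x := by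
  have := integral_exp_mul_Ioi (neg_lt_zero.2 hx) 0
  simp only [neg_mul] at this
  rw [this]
  simp

theorem integrableOn_dirichlet {W : ℝ} (hW : 0 < W) :
    IntegrableOn (fun t : ℝ =>
      Real.exp (-(W * t)) * (Real.cos W + t * Real.sin W) / (1 + t ^ 2)) (Ioi 0) := by
  refine (integrableOn_exp_neg_mul hW).mono' ?_ ?_
  · refine Continuous.aestronglyMeasurable ?_
    refine Continuous.div (by fun_prop) (by fun_prop) fun t => by positivity
  · refine ae_of_all _ fun t => ?_
    have hp : 0 < 1 + t ^ 2 := by positivity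
    rw [norm_div, norm_mul, Real.norm_of_nonneg (Real.exp_pos _).le, Real.norm_of_nonneg hp.le,
      Real.norm_eq_abs, div_le_iff₀ hp]
    exact mul_le_mul_of_nonneg_left (abs_cos_add_mul_sin_le t W) (Real.exp_pos _).le

theorem abs_integral_dirichlet_le {W : ℝ} (hW : 0 < W) :
    |∫ t in Ioi (0 : ℝ), Real.exp (-(W * t)) * (Real.cos W + t * Real.sin W) / (1 + t ^ 2)| ≤
      1 / W := by
  rw [← integral_Ioi_exp_neg_mul hW, ← Real.norm_eq_abs]
  refine norm_integral_le_of_norm_le (integrableOn_exp_neg_mul hW) (ae_of_all _ fun t => ?_)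
  have hp : 0 < 1 + t ^ 2 := by positivity
  rw [norm_div, norm_mul, Real.norm_of_nonneg (Real.exp_pos _).le, Real.norm_of_nonneg hp.le,
    Real.norm_eq_abs, div_le_iff₀ hp]
  exact mul_le_mul_of_nonneg_left (abs_cos_add_mul_sin_le t W) (Real.exp_pos _).le

theorem integrable_exp_neg_mul_sin_prod (W : ℝ) :
    Integrable (fun q : ℝ × ℝ => Real.exp (-(q.1 * q.2)) * Real.sin q.1)
      ((volume.restrict (Ioc 0 W)).prod (volume.restrict (Ioi 0))) := by
  have hcont : Continuous fun q : ℝ × ℝ => Real.exp (-(q.1 * q.2)) * Real.sin q.1 := by fun_prop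
  rw [integrable_prod_iff hcont.aestronglyMeasurable]
  constructor
  · filter_upwards [ae_restrict_mem measurableSet_Ioc] with x hx
    exact (integrableOn_exp_neg_mul hx.1).mul_const _
  · refine Integrable.mono' (g := fun _ => (1 : ℝ)) (integrable_const _)
      hcont.norm.aestronglyMeasurable.integral_prod_right' ?_
    filter_upwards [ae_restrict_mem measurableSet_Ioc] with x hx
    have h : ∀ t : ℝ, ‖Real.exp (-(x * t)) * Real.sin x‖ = Real.exp (-(x * t)) * |Real.sin x| := by
      intro t
      rw [norm_mul, Real.norm_of_nonneg (Real.exp_pos _).le, Real.norm_eq_abs]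
    simp_rw [h]
    rw [integral_mul_const, integral_Ioi_exp_neg_mul hx.1,
      Real.norm_of_nonneg (mul_nonneg (one_div_nonneg.2 hx.1.le) (abs_nonneg _)),
      one_div_mul_eq_div, div_le_one hx.1]
    simpa [abs_of_pos hx.1] using Real.abs_sin_le_abs (x := x)

/-- Write `1 / x` as the integral of `exp (-x t)` over `t > 0` and exchange the integrals. The
arctangent integral gives `π / 2`, and the remainder is at most `1 / W`. -/
theorem integral_sinc_eq {W : ℝ} (hW : 0 < W) :
    ∫ x in (0 : ℝ)..W, Real.sinc x = Real.pi / 2 -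
      ∫ t in Ioi (0 : ℝ),
        Real.exp (-(W * t)) * (Real.cos W + t * Real.sin W) / (1 + t ^ 2) := by
  have hswap := integral_integral_swap
    (f := fun x t : ℝ => Real.exp (-(x * t)) * Real.sin x) (integrable_exp_neg_mul_sin_prod W)
  have hleft : ∫ x in Ioc 0 W, ∫ t in Ioi (0 : ℝ), Real.exp (-(x * t)) * Real.sin x =
      ∫ x in (0 : ℝ)..W, Real.sinc x := by
    rw [intervalIntegral.integral_of_le hW.le]
    refine setIntegral_congr_fun measurableSet_Ioc fun x hx => ?_
    rw [integral_mul_const, integral_Ioi_exp_neg_mul hx.1, Real.sinc_of_ne_zero hx.1.ne']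
    ring
  rw [← hleft, hswap]
  have hinner : ∀ t : ℝ, ∫ x in Ioc 0 W, Real.exp (-(x * t)) * Real.sin x =
      (1 + t ^ 2)⁻¹ -
        Real.exp (-(W * t)) * (Real.cos W + t * Real.sin W) / (1 + t ^ 2) := by
    intro t
    rw [← intervalIntegral.integral_of_le hW.le, integral_exp_neg_mul_sin, sub_div, one_div]
  simp_rw [hinner]
  rw [integral_sub integrable_inv_one_add_sq.integrableOn (integrableOn_dirichlet hW),
    integral_Ioi_inv_one_add_sq]
  simp

/-- The sine integral. -/
def sineIntegral (W : ℝ) : ℝ := ∫ x in (0 : ℝ)..W, Real.sinc x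

theorem tendsto_sineIntegral : Tendsto sineIntegral atTop (𝓝 (Real.pi / 2)) := by
  rw [tendsto_iff_dist_tendsto_zero]
  refine squeeze_zero' (g := fun W : ℝ => 1 / W) (Eventually.of_forall fun _ => dist_nonneg) ?_ ?_
  · filter_upwards [eventually_gt_atTop 0] with W hW
    rw [sineIntegral, integral_sinc_eq hW, Real.dist_eq, sub_sub_cancel_left, abs_neg]
    exact abs_integral_dirichlet_le hW
  · simpa using tendsto_inv_atTop_zero (𝕜 := ℝ)

theorem sineIntegral_neg (W : ℝ) : sineIntegral (-W) = -sineIntegral W := by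
  rw [sineIntegral, sineIntegral, intervalIntegral.integral_symm]
  congr 1
  have := intervalIntegral.integral_comp_neg (a := 0) (b := W) Real.sinc
  simp only [Real.sinc_neg, neg_zero] at this
  exact this.symm

/-- Up to `1` the integrand is at most `1`; beyond, `π / 2 + 1 / W ≤ 2 + 1`. Only uniformity
matters, for dominated convergence. -/
theorem abs_sineIntegral_le_of_nonneg {W : ℝ} (hW : 0 ≤ W) : |sineIntegral W| ≤ 3 := by
  rcases le_or_gt W 1 with h | h
  · have := intervalIntegral.norm_integral_le_of_norm_le_const (a := 0) (b := W) (C := 1)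
      (f := Real.sinc) fun x _ => Real.abs_sinc_le_one x
    rw [sub_zero, one_mul, abs_of_nonneg hW] at this
    exact (this.trans h).trans (by norm_num)
  · have h0 : 0 < W := by linarith
    rw [sineIntegral, integral_sinc_eq h0]
    have h1 := abs_integral_dirichlet_le h0
    have h2 : 1 / W ≤ 1 := by rw [div_le_one h0]; exact h.le
    have h3 := Real.pi_le_four
    have h4 := Real.pi_pos
    rw [abs_le] at h1 ⊢
    constructor <;> linarith

theorem abs_sineIntegral_le (W : ℝ) : |sineIntegral W| ≤ 3 := by
  rcases le_total 0 W with h | h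
  · exact abs_sineIntegral_le_of_nonneg h
  · rw [← neg_neg W, sineIntegral_neg, abs_neg]
    exact abs_sineIntegral_le_of_nonneg (by linarith)

theorem continuous_sineIntegral : Continuous sineIntegral :=
  intervalIntegral.continuous_primitive
    (fun a b => Real.continuous_sinc.intervalIntegrable a b) 0

theorem tendsto_sineIntegral_mul_pos {x : ℝ} (hx : 0 < x) :
    Tendsto (fun W => sineIntegral (x * W)) atTop (𝓝 (Real.pi / 2)) :=
  tendsto_sineIntegral.comp (tendsto_id.const_mul_atTop hx)

theorem tendsto_sineIntegral_mul_neg {x : ℝ} (hx : x < 0) :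
    Tendsto (fun W => sineIntegral (x * W)) atTop (𝓝 (-(Real.pi / 2))) := by
  have h := (tendsto_sineIntegral_mul_pos (neg_pos.2 hx)).neg
  refine h.congr fun W => ?_
  rw [← sineIntegral_neg]; congr 1; ring

theorem integral_mul_sinc (x W : ℝ) :
    ∫ w in (-W)..W, x * Real.sinc (x * w) = 2 * sineIntegral (x * W) := by
  rw [intervalIntegral.integral_const_mul, intervalIntegral.mul_integral_comp_mul_left,
    ← intervalIntegral.integral_add_adjacent_intervals (b := 0)
      (Real.continuous_sinc.intervalIntegrable _ _) (Real.continuous_sinc.intervalIntegrable _ _),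
    intervalIntegral.integral_symm]
  have h1 := sineIntegral_neg (x * W)
  simp only [sineIntegral] at h1 ⊢
  rw [mul_neg, h1]
  ring

/-! ### Inversion formula for the distribution function -/

/-- The kernel `exp (-jωy) (exp (jaω) - 1) / (jω)`. -/
def invKernel (a y ω : ℝ) : ℂ :=
  Complex.exp (-(Complex.I * ω) * (y : ℂ)) *
    ((Complex.exp (Complex.I * (a : ℂ) * ω) - 1) / (Complex.I * ω))

/-- Follows from `|exp (iθ) - 1| ≤ |θ|`. The bound is uniform in `y`, which justifies Fubini on
bounded frequency intervals. -/
theorem norm_invKernel_le (a y ω : ℝ) : ‖invKernel a y ω‖ ≤ |a| := by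
  rw [invKernel, norm_mul]
  have h1 : ‖Complex.exp (-(Complex.I * ω) * (y : ℂ))‖ = 1 := by
    have : -(Complex.I * ω) * (y : ℂ) = ((-(ω * y) : ℝ) : ℂ) * Complex.I := by push_cast; ring
    rw [this, Complex.norm_exp_ofReal_mul_I]
  rw [h1, one_mul, norm_div, norm_mul, Complex.norm_I, one_mul, Complex.norm_real]
  rcases eq_or_ne ω 0 with rfl | hω
  · simp
  rw [div_le_iff₀ (norm_pos_iff.2 hω)]
  have : Complex.I * (a : ℂ) * ω = Complex.I * ((a * ω : ℝ) : ℂ) := by push_cast; ring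
  rw [this]
  refine (Real.norm_exp_I_mul_ofReal_sub_one_le (x := a * ω)).trans ?_
  rw [Real.norm_eq_abs, abs_mul, Real.norm_eq_abs]

theorem measurable_invKernel {β : Type*} [MeasurableSpace β] (a : ℝ) {f g : β → ℝ}
    (hf : Measurable f) (hg : Measurable g) : Measurable fun x => invKernel a (f x) (g x) := by
  unfold invKernel
  fun_prop

/-- Symmetrizing in `ω` cancels the cosines and leaves real sinc terms. The origin is excluded
because division by zero makes the left side `0` there, while the right side is `2 * a`. -/
theorem invKernel_add_neg (a y ω : ℝ) :
    invKernel a y ω + invKernel a y (-ω) =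
      ((2 * ((a - y) * Real.sinc ((a - y) * ω) + y * Real.sinc (y * ω)) : ℝ) : ℂ) ∨ ω = 0 := by
  rcases eq_or_ne ω 0 with h | hω
  · exact Or.inr h
  left
  have hsinc : ∀ x : ℝ, x * Real.sinc (x * ω) = Real.sin (x * ω) / ω := by
    intro x
    rcases eq_or_ne x 0 with rfl | hx
    · simp
    · rw [Real.sinc_of_ne_zero (mul_ne_zero hx hω)]
      field_simp
  rw [hsinc, hsinc]
  have hωc : (ω : ℂ) ≠ 0 := by exact_mod_cast hω
  have e1 : ∀ v : ℝ, invKernel a y v =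
      (Complex.exp ((((a - y) * v : ℝ) : ℂ) * Complex.I) -
        Complex.exp (((-(y * v) : ℝ) : ℂ) * Complex.I)) / (Complex.I * v) := by
    intro v
    rw [invKernel, mul_div_assoc', mul_sub, ← Complex.exp_add, mul_one]
    congr 3 <;> push_cast <;> ring_nf
  rw [e1, e1]
  simp only [Complex.exp_mul_I]
  push_cast
  simp only [mul_neg, neg_neg, Complex.cos_neg, Complex.sin_neg]
  field_simp
  ring_nf

theorem intervalIntegrable_invKernel (a y b c : ℝ) :
    IntervalIntegrable (invKernel a y) volume b c := by
  have hm : Measurable (invKernel a y) :=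
    measurable_invKernel a measurable_const measurable_id
  refine (intervalIntegrable_const (c := |a|)).mono_fun hm.aestronglyMeasurable ?_
  refine ae_of_all _ fun ω => ?_
  simpa using norm_invKernel_le a y ω

theorem integral_invKernel (a y W : ℝ) :
    ∫ ω in (-W)..W, invKernel a y ω =
      ((2 * sineIntegral ((a - y) * W) + 2 * sineIntegral (y * W) : ℝ) : ℂ) := by
  have hneg : ∫ ω in (-W)..W, invKernel a y (-ω) = ∫ ω in (-W)..W, invKernel a y ω := by
    have := intervalIntegral.integral_comp_neg (a := -W) (b := W) (invKernel a y)
    rwa [neg_neg] at this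
  have hint : IntervalIntegrable (fun ω => invKernel a y (-ω)) volume (-W) W := by
    have := (intervalIntegrable_invKernel a y W (-W)).comp_sub_left 0
    simp only [zero_sub, neg_neg] at this
    exact this
  have h2 : ∫ ω in (-W)..W, (invKernel a y ω + invKernel a y (-ω)) =
      2 * ∫ ω in (-W)..W, invKernel a y ω := by
    rw [intervalIntegral.integral_add (intervalIntegrable_invKernel a y _ _) hint, hneg, two_mul]
  have h3 : ∫ ω in (-W)..W, (invKernel a y ω + invKernel a y (-ω)) =
      ∫ ω in (-W)..W,
        ((2 * ((a - y) * Real.sinc ((a - y) * ω) + y * Real.sinc (y * ω)) : ℝ) : ℂ) := by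
    refine intervalIntegral.integral_congr_ae ?_
    have h0 : ∀ᵐ ω : ℝ, ω ≠ 0 := by
      rw [ae_iff]; simp
    filter_upwards [h0] with ω hω _
    exact (invKernel_add_neg a y ω).resolve_right hω
  have hs : ∀ x : ℝ, IntervalIntegrable (fun w => x * Real.sinc (x * w)) volume (-W) W :=
    fun x => ((Real.continuous_sinc.comp (continuous_const.mul continuous_id)).const_smul
      x).intervalIntegrable _ _
  rw [h3, intervalIntegral.integral_ofReal, intervalIntegral.integral_const_mul,
    intervalIntegral.integral_add (hs _) (hs _), integral_mul_sinc, integral_mul_sinc] at h2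
  have h4 : (2 : ℂ) ≠ 0 := two_ne_zero
  refine (mul_left_cancel₀ h4 ?_)
  rw [← h2]
  push_cast
  ring

/-- Inversion formula for the distribution function of a positive random variable: the
frequency integral of the Laplace transform on the imaginary axis recovers `μ {Y < a}`. -/
theorem hasPVIntegral_inversion {β : Type*} [MeasurableSpace β] (μ : Measure β)
    [IsFiniteMeasure μ] {Y : β → ℝ} (hY : Measurable Y) (hpos : ∀ᵐ x ∂μ, 0 < Y x) {a : ℝ}
    (ha : ∀ᵐ x ∂μ, Y x ≠ a) :
    HasPVIntegral (fun ω : ℝ => (∫ x, Complex.exp (-(Complex.I * ω) * (Y x : ℂ)) ∂μ) *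
        ((Complex.exp (Complex.I * (a : ℂ) * ω) - 1) / (Complex.I * ω)))
      (2 * Real.pi * μ.real {x | Y x < a} : ℝ) := by
  have hker : ∀ ω : ℝ, (∫ x, Complex.exp (-(Complex.I * ω) * (Y x : ℂ)) ∂μ) *
        ((Complex.exp (Complex.I * (a : ℂ) * ω) - 1) / (Complex.I * ω)) =
      ∫ x, invKernel a (Y x) ω ∂μ := by
    intro ω
    simp only [invKernel]
    rw [integral_mul_const]
  simp_rw [hker]
  have hmeas : Measurable fun q : ℝ × β => invKernel a (Y q.2) q.1 :=
    measurable_invKernel a (hY.comp measurable_snd) measurable_fst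
  have hprod : ∀ b c : ℝ, Integrable (fun q : ℝ × β => invKernel a (Y q.2) q.1)
      ((volume.restrict (Ioc b c)).prod μ) := by
    intro b c
    refine Integrable.mono' (integrable_const |a|) hmeas.aestronglyMeasurable ?_
    exact ae_of_all _ fun q => norm_invKernel_le _ _ _
  refine ⟨fun W => ?_, ?_⟩
  · exact ⟨(hprod _ _).integral_prod_left, (hprod _ _).integral_prod_left⟩
  have hval : ∀ᶠ W : ℝ in atTop, ∫ x, ((2 * sineIntegral ((a - Y x) * W) +
      2 * sineIntegral (Y x * W) : ℝ) : ℂ) ∂μ =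
        ∫ ω in (-W)..W, ∫ x, invKernel a (Y x) ω ∂μ := by
    filter_upwards [eventually_ge_atTop 0] with W hW
    rw [intervalIntegral.integral_of_le (by linarith), integral_integral_swap (hprod _ _)]
    refine integral_congr_ae (ae_of_all _ fun x => ?_)
    beta_reduce
    rw [← intervalIntegral.integral_of_le (by linarith), integral_invKernel]
  refine Tendsto.congr' hval ?_
  have hlim : ((2 * Real.pi * μ.real {x | Y x < a} : ℝ) : ℂ) =
      ∫ x, (({x | Y x < a}.indicator (fun _ => 2 * Real.pi) x : ℝ) : ℂ) ∂μ := by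
    rw [integral_complex_ofReal, integral_indicator_const _ (measurableSet_lt hY measurable_const),
      smul_eq_mul, mul_comm]
  rw [hlim]
  -- The two terms `2 * sineIntegral` are each at most `6` in absolute value. Their limits are `±π`,
  -- with the sign of `a - Y x`, and `π`, since `Y x > 0`.
  refine tendsto_integral_filter_of_dominated_convergence (fun _ => (12 : ℝ)) ?_ ?_
    (integrable_const _) ?_
  · refine Eventually.of_forall fun W => ?_
    refine Measurable.aestronglyMeasurable (Complex.measurable_ofReal.comp ?_)
    have := continuous_sineIntegral.measurable
    exact ((this.comp ((measurable_const.sub hY).mul_const W)).const_mul 2).add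
      ((this.comp (hY.mul_const W)).const_mul 2)
  · refine Eventually.of_forall fun W => ae_of_all _ fun x => ?_
    rw [Complex.norm_real, Real.norm_eq_abs, abs_le]
    have h1 := abs_le.1 (abs_sineIntegral_le ((a - Y x) * W))
    have h2 := abs_le.1 (abs_sineIntegral_le (Y x * W))
    constructor <;> linarith [h1.1, h1.2, h2.1, h2.2]
  · filter_upwards [hpos, ha] with x hx hxa
    refine (Complex.continuous_ofReal.tendsto _).comp ?_
    have h2 := (tendsto_sineIntegral_mul_pos hx).const_mul 2
    rcases hxa.lt_or_gt with h | h
    · rw [indicator_of_mem (show x ∈ {x | Y x < a} from h)]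
      have h1 := (tendsto_sineIntegral_mul_pos (sub_pos.2 h)).const_mul 2
      convert h1.add h2 using 2; ring
    · rw [indicator_of_notMem (show x ∉ {x | Y x < a} from fun h' => absurd h' h.le.not_gt)]
      have h1 := (tendsto_sineIntegral_mul_neg (sub_neg.2 h)).const_mul 2
      convert h1.add h2 using 2; ring

end

end LEO

namespace LEO

noncomputable section

namespace Network

variable {p : Params} {Ω : Type*} [MeasurableSpace Ω] {P : Measure Ω} (M : Network p Ω P)

/-! ### Measurability -/

theorem measurable_R (i : Fin p.N) : Measurable (M.R i) :=
  measurable_const.dist (M.pos_meas i)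

theorem mem_nearest {i : Fin p.N} {w : Ω} : i ∈ M.nearest w ↔ ∀ j, M.R i w ≤ M.R j w := by
  simp [nearest]

theorem R0_le (w : Ω) (j : Fin p.N) : M.R0 w ≤ M.R j w :=
  M.mem_nearest.1 (Finset.min'_mem _ (M.nearest_nonempty w)) j

theorem serving_eq_iff {i : Fin p.N} {w : Ω} :
    M.serving w = i ↔ (∀ j, M.R i w ≤ M.R j w) ∧
      ∀ k, (∀ j, M.R k w ≤ M.R j w) → i ≤ k := by
  rw [serving, Finset.min'_eq_iff]
  simp [mem_nearest]

theorem measurable_serving : Measurable M.serving := by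
  refine measurable_to_countable' fun i => ?_
  have hR : ∀ k, Measurable fun w => ∀ j, M.R k w ≤ M.R j w := fun k =>
    Measurable.forall fun j =>
      measurableSet_setOfPred.1 (measurableSet_le (M.measurable_R k) (M.measurable_R j))
  have hset : M.serving ⁻¹' {i} = {w | (∀ j, M.R i w ≤ M.R j w) ∧
      ∀ k, (∀ j, M.R k w ≤ M.R j w) → i ≤ k} := by
    ext w; exact M.serving_eq_iff
  rw [hset]
  exact measurableSet_setOfPred.2 ((hR i).and (Measurable.forall fun k =>
    (hR k).imp measurable_const))

theorem measurable_apply_serving {β : Type*} [MeasurableSpace β] {f : Fin p.N → Ω → β}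
    (hf : ∀ i, Measurable (f i)) : Measurable fun w => f (M.serving w) w :=
  (measurable_from_prod_countable_right (f := fun q : Fin p.N × Ω => f q.1 q.2) hf).comp
    (M.measurable_serving.prodMk measurable_id)

theorem measurable_R0 : Measurable M.R0 := M.measurable_apply_serving M.measurable_R

theorem measurable_chan_apply (i : Fin p.N) : Measurable fun w => M.chan w i :=
  (measurable_pi_apply i).comp M.chan_meas

theorem mem_interferers {i : Fin p.N} {w : Ω} : i ∈ M.interferers w ↔
    i ≠ M.serving w ∧ M.chan w i = M.chan w (M.serving w) ∧ M.R i w ≤ p.rMax := by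
  simp [interferers]

theorem measurableSet_mem_interferers (i : Fin p.N) : MeasurableSet {w | i ∈ M.interferers w} := by
  simp only [mem_interferers, ofPred_and]
  refine MeasurableSet.inter ?_ (MeasurableSet.inter ?_ ?_)
  · exact (measurableSet_eq_fun measurable_const M.measurable_serving).compl
  · exact measurableSet_eq_fun (M.measurable_chan_apply i)
      (M.measurable_apply_serving M.measurable_chan_apply)
  · exact measurableSet_le (M.measurable_R i) measurable_const

open Classical in
theorem sum_interferers {β : Type*} [AddCommMonoid β] (f : Fin p.N → β) (w : Ω) :
    ∑ i ∈ M.interferers w, f i = ∑ i, if i ∈ M.interferers w then f i else 0 := by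
  rw [Finset.sum_ite_mem, Finset.univ_inter]

theorem measurable_NI : Measurable M.NI := by
  classical
  have : M.NI = fun w => ∑ i, if i ∈ M.interferers w then 1 else 0 := by
    funext w
    rw [NI, Finset.card_eq_sum_ones, M.sum_interferers]
  rw [this]
  exact Finset.measurable_sum _ fun i _ =>
    Measurable.ite (M.measurableSet_mem_interferers i) measurable_const measurable_const

theorem measurable_I : Measurable M.I := by
  classical
  have : M.I = fun w => ∑ i, if i ∈ M.interferers w then
      p.pI * M.gain i w * M.R i w ^ (-p.α) else 0 := by
    funext w
    rw [I, M.sum_interferers]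
  rw [this]
  refine Finset.measurable_sum _ fun i _ =>
    Measurable.ite (M.measurableSet_mem_interferers i) ?_ measurable_const
  exact ((M.gain_meas i).const_mul _).mul ((M.measurable_R i).pow_const _)

theorem measurable_SINR : Measurable M.SINR := by
  have hG : Measurable M.G0 :=
    Measurable.ite (measurableSet_le M.measurable_R0 measurable_const) measurable_const
      measurable_const
  exact ((hG.const_mul _).mul (M.measurable_R0.pow_const _)).div
    (M.measurable_I.add measurable_const)

/-! ### The joint law of the distances -/

theorem map_R (i : Fin p.N) : P.map (M.R i) = p.distLaw := by
  have h : M.R i = (fun x => dist M.user x) ∘ M.pos i := rfl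
  rw [h, ← Measure.map_map (by fun_prop) (M.pos_meas i), M.pos_law i,
    map_dist_uniformSphere p M.user_norm]

theorem map_distances [IsProbabilityMeasure P] : P.map (fun w i => M.R i w) = Measure.pi fun _ => p.distLaw := by
  have hind : iIndepFun M.R P :=
    M.pos_indep.comp (fun _ x => dist M.user x) fun _ => by fun_prop
  rw [(iIndepFun_iff_map_fun_eq_pi_map fun i => (M.measurable_R i).aemeasurable).1 hind]
  simp_rw [M.map_R]

theorem distances_indep :
    IndepFun (fun w i => M.R i w) (fun w => ((fun i => M.gain i w), M.chan w)) P := by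
  have h := M.pos_indep_rest.comp
    (φ := fun x : Fin p.N → E3 => fun i => dist M.user (x i)) (ψ := id)
    (by fun_prop) measurable_id
  exact h

theorem ae_R_mem : ∀ᵐ w ∂P, ∀ i, M.R i w ∈ Icc p.rMin p.rFar := by
  refine ae_all_iff.2 fun i => ?_
  have h := p.ae_distLaw_mem
  rw [← M.map_R i] at h
  exact ae_of_ae_map (M.measurable_R i).aemeasurable h

theorem serving_eq_iff_of_ne {w : Ω} (hw : ∀ i j, i ≠ j → M.R i w ≠ M.R j w) (i : Fin p.N) :
    M.serving w = i ↔ ∀ j, j ≠ i → M.R i w < M.R j w := by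
  constructor
  · rintro rfl j hj
    exact lt_of_le_of_ne (M.R0_le w j) (hw _ _ hj.symm)
  · intro h
    by_contra hne
    exact absurd (M.R0_le w i) (not_le.2 (h _ hne))

theorem measure_eq_sum_serving (A : Set Ω) : P A = ∑ i, P (M.serving ⁻¹' {i} ∩ A) := by
  have h := sum_measure_preimage_singleton (μ := P.restrict A) (Finset.univ : Finset (Fin p.N))
    (f := M.serving) fun i _ => M.measurable_serving (measurableSet_singleton i)
  simp only [Finset.coe_univ, preimage_univ, Measure.restrict_apply_univ] at h
  rw [← h]
  exact Finset.sum_congr rfl fun i _ =>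
    Measure.restrict_apply (M.measurable_serving (measurableSet_singleton i))

theorem NI_eq_zero_iff {w : Ω} : M.NI w = 0 ↔
    ∀ j, j ≠ M.serving w → M.chan w j = M.chan w (M.serving w) → p.rMax < M.R j w := by
  rw [NI, Finset.card_eq_zero, Finset.eq_empty_iff_forall_notMem]
  simp only [mem_interferers, not_and, not_le]

theorem I_eq_zero {w : Ω} (h : M.NI w = 0) : M.I w = 0 := by
  rw [I, Finset.card_eq_zero.1 h, Finset.sum_empty]

theorem R0_le_rMax_of_NI_pos {w : Ω} (h : 0 < M.NI w) : M.R0 w ≤ p.rMax := by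
  obtain ⟨j, hj⟩ := Finset.card_pos.1 h
  exact (M.R0_le w j).trans (M.mem_interferers.1 hj).2.2

theorem ae_interference_pos : ∀ᵐ w ∂P, 0 < M.NI w → 0 < M.I w := by
  filter_upwards [ae_all_iff.2 M.gain_pos, M.ae_R_mem] with w hg hR hNI
  refine Finset.sum_pos (fun j _ => ?_) (Finset.card_pos.1 hNI)
  have h1 := p.pI_pos
  have h2 := hg j
  have h3 := Real.rpow_pos_of_pos (p.rMin_pos.trans_le (hR j).1) (-p.α)
  positivity

end Network

/-! ### Product measures on `ι → ℝ` -/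

/-- Fubini with coordinate `j` integrated first. It is used with fibres of at most one point and an
atomless `ν`. -/
theorem pi_null_of_update {ι : Type*} [Fintype ι] [DecidableEq ι] (ν : Measure ℝ)
    [IsProbabilityMeasure ν] {E : Set (ι → ℝ)} (hE : MeasurableSet E) (j : ι)
    (h : ∀ x : ι → ℝ, ν {t | Function.update x j t ∈ E} = 0) :
    Measure.pi (fun _ => ν) E = 0 := by
  rw [← lintegral_indicator_one hE, lintegral_eq_lmarginal_univ (fun _ => 0),
    lmarginal_erase' _ (measurable_one.indicator hE) (Finset.mem_univ j)]
  have : (fun x : ι → ℝ => ∫⁻ t, E.indicator 1 (Function.update x j t) ∂ν) =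
      (fun _ => (0 : ENNReal)) := by
    funext x
    have hm : MeasurableSet {t | Function.update x j t ∈ E} :=
      (measurable_update x (a := j)) hE
    rw [← h x, ← lintegral_indicator_one hm]
    rfl
  rw [this]
  simp [lmarginal]

/-- Once coordinate `i` is fixed the others are independent, so the slice is a box. Separate
thresholds allow for different constraints on and off the serving channel. -/
theorem pi_first_coordinate (n : ℕ) (ν : Measure ℝ) [IsProbabilityMeasure ν] (i : Fin n)
    {B : Set ℝ} (hB : MeasurableSet B) {thr : Fin n → ℝ → ℝ} (hthr : ∀ j, Measurable (thr j)) :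
    Measure.pi (fun _ : Fin n => ν) {x | x i ∈ B ∧ ∀ j, j ≠ i → thr j (x i) < x j} =
      ∫⁻ r in B, ∏ j ∈ Finset.univ.erase i, ν (Ioi (thr j r)) ∂ν := by
  cases n with
  | zero => exact i.elim0
  | succ n =>
    let S : Set (ℝ × (Fin n → ℝ)) :=
      {q | q.1 ∈ B ∧ ∀ j, thr (i.succAbove j) q.1 < q.2 j}
    have hS : MeasurableSet S := by
      refine measurableSet_setOfPred.2 (Measurable.and (measurable_fst hB).mem
        (Measurable.forall fun j => measurableSet_setOfPred.1 (measurableSet_lt ?_ ?_)))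
      · exact (hthr _).comp measurable_fst
      · fun_prop
    have hpre : {x : Fin (n + 1) → ℝ | x i ∈ B ∧ ∀ j, j ≠ i → thr j (x i) < x j} =
        MeasurableEquiv.piFinSuccAbove (fun _ => ℝ) i ⁻¹' S := by
      ext x
      have hiff : (∀ j, j ≠ i → thr j (x i) < x j) ↔
          ∀ j, thr (i.succAbove j) (x i) < x (i.succAbove j) := by
        constructor
        · exact fun h j => h _ (i.succAbove_ne j)
        · intro h j hj
          obtain ⟨k, rfl⟩ := Fin.exists_succAbove_eq hj
          exact h k
      exact and_congr_right fun _ => hiff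
    rw [hpre, (measurePreserving_piFinSuccAbove (fun _ : Fin (n + 1) => ν) i).measure_preimage
      hS.nullMeasurableSet, Measure.prod_apply hS, ← lintegral_indicator hB]
    refine lintegral_congr fun r => ?_
    by_cases hr : r ∈ B
    · rw [indicator_of_mem hr]
      have : Prod.mk r ⁻¹' S = univ.pi fun j => Ioi (thr (i.succAbove j) r) := by
        ext x; simp [S, hr]
      rw [this, Measure.pi_pi]
      have himg : (Finset.univ.erase i : Finset (Fin (n + 1))) =
          Finset.univ.map i.succAboveEmb := by
        ext j
        simp only [Finset.mem_erase, Finset.mem_univ, and_true, Finset.mem_map, true_and]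
        exact Fin.exists_succAbove_eq_iff.symm
      rw [himg, Finset.prod_map]
      rfl
    · rw [indicator_of_notMem hr]
      have : Prod.mk r ⁻¹' S = ∅ := by
        ext x; simp [S, hr]
      rw [this, measure_empty]

end

end LEO

namespace LEO

noncomputable section

/-! ### The horizon, the value of `P0` and the serving density -/

namespace Params

variable (p : Params)

theorem rMin_le_rMax : p.rMin ≤ p.rMax := by
  have h1 := p.rE_pos
  have h2 := p.rMin_pos
  refine Real.le_sqrt_of_sq_le ?_
  nlinarith [mul_pos h1 h2]

theorem rMax_lt_rFar : p.rMax < p.rFar := by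
  have h1 := p.rE_pos
  have h2 := p.rMin_pos
  rw [rMax, rFar, Real.sqrt_lt' (by positivity)]
  nlinarith [mul_pos h1 h2]

theorem rMax_sq : p.rMax ^ 2 = 2 * p.rE * p.rMin + p.rMin ^ 2 := by
  have h1 := p.rE_pos
  have h2 := p.rMin_pos
  exact Real.sq_sqrt (by positivity)

theorem rMax_mem : p.rMax ∈ Icc p.rMin p.rFar := ⟨p.rMin_le_rMax, p.rMax_lt_rFar.le⟩

/-- Numerator and denominator of `interfProb` share the factor `2 * (rE + rMin)`. What remains is
the conditional probability of lying beyond the horizon given lying beyond `r`. -/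
theorem one_sub_interfProb {r : ℝ} (hr : r ∈ Icc p.rMin p.rMax) :
    1 - p.interfProb r = p.tail p.rMax / p.tail r := by
  have h1 := p.rE_pos
  have h2 := p.rMin_pos
  have ht := p.tail_pos (h2.le.trans hr.1) (hr.2.trans_lt p.rMax_lt_rFar)
  have hden : 2 * (p.rE + p.rMin) - (r ^ 2 - p.rMin ^ 2) / (2 * p.rE) =
      2 * (p.rE + p.rMin) * p.tail r := by
    rw [tail]; field_simp; ring
  have hnum : p.rMin - (r ^ 2 - p.rMin ^ 2) / (2 * p.rE) =
      2 * (p.rE + p.rMin) * (p.tail r - p.tail p.rMax) := by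
    rw [tail, tail, p.rMax_sq]; field_simp; ring
  rw [interfProb, hden, hnum]
  field_simp
  ring

theorem P0_nonneg {r : ℝ} (hr : p.rMin ≤ r) : 0 ≤ p.P0 r := by
  unfold P0
  split_ifs with h
  · rw [p.one_sub_interfProb ⟨hr, h⟩]
    have h0 := p.rMin_pos.le
    exact pow_nonneg (div_nonneg (p.tail_nonneg (h0.trans p.rMin_le_rMax) p.rMax_lt_rFar.le)
      (p.tail_nonneg (h0.trans hr) (h.trans p.rMax_lt_rFar.le))) _
  · exact zero_le_one

theorem P0_le_one {r : ℝ} (hr : p.rMin ≤ r) : p.P0 r ≤ 1 := by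
  unfold P0
  split_ifs with h
  · rw [p.one_sub_interfProb ⟨hr, h⟩]
    have h0 := p.rMin_pos.le
    have ht := p.tail_pos (h0.trans hr) (h.trans_lt p.rMax_lt_rFar)
    refine pow_le_one₀ (div_nonneg (p.tail_nonneg (h0.trans p.rMin_le_rMax) p.rMax_lt_rFar.le)
      ht.le) ?_
    rw [div_le_one ht]
    exact p.tail_anti (h0.trans hr) h
  · exact le_rfl

theorem measurable_P0 : Measurable p.P0 := by
  refine Measurable.ite measurableSet_Iic ?_ measurable_const
  unfold interfProb
  fun_prop

/-- The density of the serving distance on `[rMin, rFar]`. -/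
def servingDensity (r : ℝ) : ℝ :=
  p.N * p.tail r ^ (p.N - 1) * (r / (2 * p.rE * (p.rE + p.rMin)))

theorem servingDensity_pos {r : ℝ} (hr : r ∈ Icc p.rMin p.rMax) : 0 < p.servingDensity r := by
  have h1 := p.rE_pos
  have h2 := p.rMin_pos
  have h3 : 0 < r := h2.trans_le hr.1
  have h4 := p.tail_pos h3.le (hr.2.trans_lt p.rMax_lt_rFar)
  have h5 : (0 : ℝ) < p.N := by exact_mod_cast p.N_pos
  unfold servingDensity
  positivity

theorem continuous_servingDensity : Continuous p.servingDensity := by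
  have := p.continuous_tail
  unfold servingDensity
  fun_prop

/-- The product over the other satellites of the probabilities to be beyond the serving distance,
and beyond the horizon if on the serving channel. -/
theorem prod_distLaw_Ioi_same_channel {c : Fin p.N → Fin p.K} (i : Fin p.N)
    (hc : (Finset.univ.filter fun j => c j = c i).card = p.N / p.K) {r : ℝ}
    (hr : r ∈ Icc p.rMin p.rFar) :
    ∏ j ∈ Finset.univ.erase i, p.distLaw (Ioi (if c j = c i then max r p.rMax else r)) =
      ENNReal.ofReal (p.tail r ^ (p.N - 1)) * ENNReal.ofReal (p.P0 r) := by
  have h0 : 0 ≤ r := p.rMin_pos.le.trans hr.1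
  have htr := p.tail_nonneg h0 hr.2
  have hcard : (Finset.univ.erase i).card = p.N - 1 := by
    rw [Finset.card_erase_of_mem (Finset.mem_univ i), Finset.card_fin]
  rcases le_or_gt r p.rMax with h | h
  · have hfac : ∀ j ∈ Finset.univ.erase i,
        p.distLaw (Ioi (if c j = c i then max r p.rMax else r)) =
          ENNReal.ofReal (if c j = c i then p.tail p.rMax else p.tail r) := by
      intro j _
      split_ifs
      · rw [max_eq_right h, p.distLaw_Ioi p.rMax_mem]
      · rw [p.distLaw_Ioi hr]
    have htm : 0 ≤ p.tail p.rMax :=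
      p.tail_nonneg (p.rMin_pos.le.trans p.rMin_le_rMax) p.rMax_lt_rFar.le
    have ht := p.tail_pos h0 (h.trans_lt p.rMax_lt_rFar)
    rw [Finset.prod_congr rfl hfac, ← ENNReal.ofReal_prod_of_nonneg
      (fun j _ => by split_ifs <;> assumption), ← ENNReal.ofReal_mul (pow_nonneg htr _),
      Finset.prod_ite, Finset.prod_const, Finset.prod_const]
    congr 1
    -- The serving satellite counts among those on its own channel, hence the `- 1` in the exponent
    -- of `P0`.
    have hsame : ((Finset.univ.erase i).filter fun j => c j = c i).card = p.N / p.K - 1 := by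
      rw [Finset.filter_erase, Finset.card_erase_of_mem (by simp), hc]
    have hother : ((Finset.univ.erase i).filter fun j => ¬ c j = c i).card =
        (p.N - 1) - (p.N / p.K - 1) := by
      have := Finset.card_filter_add_card_filter_not (s := Finset.univ.erase i)
        (fun j => c j = c i)
      rw [hsame, hcard] at this
      omega
    have hle : p.N / p.K - 1 ≤ p.N - 1 := Nat.sub_le_sub_right (Nat.div_le_self _ _) _
    rw [hsame, hother, P0, if_pos h, p.one_sub_interfProb ⟨hr.1, h⟩, div_pow]
    rw [pow_sub₀ _ ht.ne' hle]
    field_simp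
  · have hfac : ∀ j ∈ Finset.univ.erase i,
        p.distLaw (Ioi (if c j = c i then max r p.rMax else r)) = ENNReal.ofReal (p.tail r) := by
      intro j _
      rw [max_eq_left h.le, ite_self, p.distLaw_Ioi hr]
    rw [Finset.prod_congr rfl hfac, Finset.prod_const, hcard, P0, if_neg h.not_ge,
      ENNReal.ofReal_one, mul_one, ENNReal.ofReal_pow htr]

end Params

namespace Network

variable {p : Params} {Ω : Type*} [MeasurableSpace Ω] {P : Measure Ω} [IsProbabilityMeasure P]
  (M : Network p Ω P)

/-! ### The law of the serving distance and the probability of no interference -/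

theorem ae_R_ne : ∀ᵐ w ∂P, ∀ i j, i ≠ j → M.R i w ≠ M.R j w := by
  refine ae_all_iff.2 fun i => ae_all_iff.2 fun j => ?_
  by_cases hij : i = j
  · exact ae_of_all _ fun _ h => absurd hij h
  have hmeas : MeasurableSet {x : Fin p.N → ℝ | x i = x j} :=
    measurableSet_eq_fun (measurable_pi_apply i) (measurable_pi_apply j)
  have hnull : P {w | M.R i w = M.R j w} = 0 := by
    have h := Measure.map_apply (μ := P) (measurable_pi_lambda _ M.measurable_R) hmeas
    rw [M.map_distances] at h
    refine h.symm.trans (pi_null_of_update p.distLaw hmeas j fun x => ?_)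
    refine measure_mono_null (t := {x i}) (fun t ht => ?_) (measure_singleton _)
    simp only [mem_ofPred_eq, Function.update_self, Function.update_of_ne hij] at ht
    exact ht.symm
  filter_upwards [measure_eq_zero_iff_ae_notMem.1 hnull] with w hw _ h using hw h

/-- The assignment is independent of the distances, so it can be frozen and `pi_first_coordinate`
applied to each value of it. -/
theorem measure_first_of_threshold (i : Fin p.N) {B : Set ℝ} (hB : MeasurableSet B)
    {thr : Fin p.N → (Fin p.N → Fin p.K) → ℝ → ℝ} (hthr : ∀ j c, Measurable (thr j c)) :
    P {w | M.R i w ∈ B ∧ ∀ j, j ≠ i → thr j (M.chan w) (M.R i w) < M.R j w} =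
      ∫⁻ w, ∫⁻ r in B, ∏ j ∈ Finset.univ.erase i, p.distLaw (Ioi (thr j (M.chan w) r))
        ∂p.distLaw ∂P := by
  have hind : IndepFun (fun w i => M.R i w) M.chan P :=
    M.distances_indep.comp measurable_id measurable_snd
  have hR : Measurable fun w i => M.R i w := measurable_pi_lambda _ M.measurable_R
  have hmap := (indepFun_iff_map_prod_eq_prod_map_map hR.aemeasurable
    M.chan_meas.aemeasurable).1 hind
  let S : Set ((Fin p.N → ℝ) × (Fin p.N → Fin p.K)) :=
    {q | q.1 i ∈ B ∧ ∀ j, j ≠ i → thr j q.2 (q.1 i) < q.1 j}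
  have hslice : ∀ c, MeasurableSet {x : Fin p.N → ℝ | x i ∈ B ∧
      ∀ j, j ≠ i → thr j c (x i) < x j} := by
    intro c
    refine measurableSet_setOfPred.2 (Measurable.and ((measurable_pi_apply i) hB).mem
      (Measurable.forall fun j => Measurable.imp measurable_const
        (measurableSet_setOfPred.1 (measurableSet_lt ?_ (measurable_pi_apply j)))))
    exact (hthr j c).comp (measurable_pi_apply i)
  have hS : MeasurableSet S := by
    have : S = ⋃ c, {x : Fin p.N → ℝ | x i ∈ B ∧ ∀ j, j ≠ i → thr j c (x i) < x j} ×ˢ {c} := by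
      ext ⟨x, c⟩; simp [S]
    rw [this]
    exact MeasurableSet.iUnion fun c => (hslice c).prod (measurableSet_singleton c)
  have h1 : P {w | M.R i w ∈ B ∧ ∀ j, j ≠ i → thr j (M.chan w) (M.R i w) < M.R j w} =
      P.map (fun w => ((fun i => M.R i w), M.chan w)) S :=
    (Measure.map_apply (hR.prodMk M.chan_meas) hS).symm
  rw [h1, hmap, M.map_distances]
  have : IsProbabilityMeasure (P.map M.chan) :=
    Measure.isProbabilityMeasure_map M.chan_meas.aemeasurable
  rw [Measure.prod_apply_symm hS, lintegral_map (measurable_of_countable _) M.chan_meas]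
  refine lintegral_congr fun w => ?_
  exact pi_first_coordinate p.N p.distLaw i hB (fun j => hthr j (M.chan w))

/-- Each satellite is equally likely to serve at distance `r`, the other `N - 1` being farther; the
`N` equal contributions add up. -/
theorem servingLaw_apply {B : Set ℝ} (hB : MeasurableSet B) :
    M.servingLaw B = ∫⁻ r in B, ENNReal.ofReal (p.servingDensity r)
      ∂(volume.restrict (Icc p.rMin p.rFar)) := by
  have hi : ∀ i, P (M.serving ⁻¹' {i} ∩ M.R0 ⁻¹' B) =
      ∫⁻ r in B, ENNReal.ofReal (p.tail r ^ (p.N - 1)) ∂p.distLaw := by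
    intro i
    have h := M.measure_first_of_threshold i hB (thr := fun _ _ r => r) fun _ _ => measurable_id
    rw [lintegral_const, measure_univ, mul_one] at h
    have hprod : ∫⁻ r in B, ∏ j ∈ Finset.univ.erase i, p.distLaw (Ioi r) ∂p.distLaw =
        ∫⁻ r in B, ENNReal.ofReal (p.tail r ^ (p.N - 1)) ∂p.distLaw := by
      refine lintegral_congr_ae (ae_restrict_of_ae ?_)
      filter_upwards [p.ae_distLaw_mem] with r hr
      rw [Finset.prod_const, Finset.card_erase_of_mem (Finset.mem_univ i), Finset.card_fin,
        p.distLaw_Ioi hr, ENNReal.ofReal_pow (p.tail_nonneg (p.rMin_pos.le.trans hr.1) hr.2)]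
    rw [← hprod, ← h]
    refine measure_congr ?_
    filter_upwards [M.ae_R_ne] with w hw
    refine propext ?_
    change (M.serving w = i ∧ M.R0 w ∈ B) ↔ _ ∧ _
    rw [M.serving_eq_iff_of_ne hw, and_comm]
    refine and_congr_left fun h => ?_
    rw [R0, (M.serving_eq_iff_of_ne hw i).2 h]
  rw [servingLaw, Measure.map_apply M.measurable_R0 hB, M.measure_eq_sum_serving]
  simp_rw [hi]
  rw [Finset.sum_const, Finset.card_fin, nsmul_eq_mul, Params.distLaw,
    restrict_withDensity hB, lintegral_withDensity_eq_lintegral_mul _ (by fun_prop)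
      (by have := p.continuous_tail; fun_prop), ← lintegral_const_mul _ (by
        have := p.continuous_tail; fun_prop)]
  refine lintegral_congr_ae (ae_restrict_of_ae ?_)
  filter_upwards [ae_restrict_mem measurableSet_Icc] with r hr
  have h1 := p.rE_pos
  have h2 := p.rMin_pos
  have h3 : 0 ≤ r := h2.le.trans hr.1
  rw [Pi.mul_apply, ← ENNReal.ofReal_mul (by positivity), ← ENNReal.ofReal_natCast,
    ← ENNReal.ofReal_mul (by positivity), Params.servingDensity]
  congr 1; ring

theorem servingLaw_eq : M.servingLaw = (volume.restrict (Icc p.rMin p.rFar)).withDensity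
    fun r => ENNReal.ofReal (p.servingDensity r) := by
  ext B hB
  rw [M.servingLaw_apply hB, withDensity_apply _ hB]

theorem measure_R0_mem_NI_eq_zero {B : Set ℝ} (hB : MeasurableSet B) :
    P {w | M.R0 w ∈ B ∧ M.NI w = 0} = ∫⁻ r in B, ENNReal.ofReal (p.P0 r) ∂M.servingLaw := by
  have hi : ∀ i, P (M.serving ⁻¹' {i} ∩ {w | M.R0 w ∈ B ∧ M.NI w = 0}) =
      ∫⁻ r in B, ENNReal.ofReal (p.tail r ^ (p.N - 1)) * ENNReal.ofReal (p.P0 r) ∂p.distLaw := by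
    intro i
    -- One threshold encodes both constraints: farther than the serving satellite and, on its
    -- channel, also beyond the horizon.
    have h := M.measure_first_of_threshold i hB
      (thr := fun j c r => if c j = c i then max r p.rMax else r) fun j c => by
        split_ifs <;> fun_prop
    have hconst : ∀ᵐ w ∂P, ∫⁻ r in B, ∏ j ∈ Finset.univ.erase i,
        p.distLaw (Ioi (if M.chan w j = M.chan w i then max r p.rMax else r)) ∂p.distLaw =
        ∫⁻ r in B, ENNReal.ofReal (p.tail r ^ (p.N - 1)) * ENNReal.ofReal (p.P0 r)
          ∂p.distLaw := by
      filter_upwards [M.chan_balanced] with w hw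
      refine lintegral_congr_ae (ae_restrict_of_ae ?_)
      filter_upwards [p.ae_distLaw_mem] with r hr
      exact p.prod_distLaw_Ioi_same_channel i (hw _) hr
    rw [lintegral_congr_ae hconst, lintegral_const, measure_univ, mul_one] at h
    rw [← h]
    refine measure_congr ?_
    filter_upwards [M.ae_R_ne] with w hw
    refine propext ?_
    change (M.serving w = i ∧ M.R0 w ∈ B ∧ M.NI w = 0) ↔ (M.R i w ∈ B ∧ ∀ j, j ≠ i →
      (if M.chan w j = M.chan w i then max (M.R i w) p.rMax else M.R i w) < M.R j w)
    constructor
    · rintro ⟨rfl, h1, h2⟩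
      refine ⟨h1, fun j hj => ?_⟩
      have h3 := (M.serving_eq_iff_of_ne hw _).1 rfl j hj
      split_ifs with hc
      · exact max_lt h3 (M.NI_eq_zero_iff.1 h2 j hj hc)
      · exact h3
    · rintro ⟨h1, h2⟩
      have hs : M.serving w = i := by
        refine (M.serving_eq_iff_of_ne hw i).2 fun j hj => lt_of_le_of_lt ?_ (h2 j hj)
        split_ifs
        · exact le_max_left _ _
        · exact le_rfl
      refine ⟨hs, by rw [R0, hs]; exact h1, M.NI_eq_zero_iff.2 fun j hj hc => ?_⟩
      rw [hs] at hj hc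
      have := h2 j hj
      rw [if_pos hc] at this
      exact (le_max_right _ _).trans_lt this
  have hP0 : Measurable fun r => ENNReal.ofReal (p.P0 r) := p.measurable_P0.ennreal_ofReal
  have ht : Measurable fun r => ENNReal.ofReal (p.tail r ^ (p.N - 1)) := by
    have := p.continuous_tail; fun_prop
  have htP : Measurable fun r =>
      ENNReal.ofReal (p.tail r ^ (p.N - 1)) * ENNReal.ofReal (p.P0 r) := ht.mul hP0
  rw [M.measure_eq_sum_serving]
  simp_rw [hi]
  rw [Finset.sum_const, Finset.card_fin, nsmul_eq_mul, Params.distLaw, M.servingLaw_eq,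
    restrict_withDensity hB, restrict_withDensity hB,
    lintegral_withDensity_eq_lintegral_mul _ (by fun_prop) htP,
    lintegral_withDensity_eq_lintegral_mul _
      p.continuous_servingDensity.measurable.ennreal_ofReal hP0,
    ← lintegral_const_mul _ (Measurable.mul (by fun_prop) htP)]
  refine lintegral_congr_ae (ae_restrict_of_ae ?_)
  filter_upwards [ae_restrict_mem measurableSet_Icc] with r hr
  have h1 := p.rE_pos
  have h2 := p.rMin_pos
  have h3 : 0 ≤ r := h2.le.trans hr.1
  have h4 := p.tail_nonneg h3 hr.2
  simp only [Pi.mul_apply]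
  rw [← mul_assoc, ← mul_assoc, ← ENNReal.ofReal_natCast, ← ENNReal.ofReal_mul (by positivity),
    ← ENNReal.ofReal_mul (by positivity), Params.servingDensity]
  congr 2; ring

theorem ae_servingLaw_mem : ∀ᵐ r ∂M.servingLaw, r ∈ Icc p.rMin p.rFar := by
  rw [M.servingLaw_eq]
  exact (withDensity_absolutelyContinuous _ _).ae_le (ae_restrict_mem measurableSet_Icc)

instance : NullSingletonClass M.servingLaw := by
  rw [M.servingLaw_eq]; infer_instance

instance : IsProbabilityMeasure M.servingLaw :=
  Measure.isProbabilityMeasure_map M.measurable_R0.aemeasurable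

/-- The serving density is positive on this interval. This turns "for almost every serving distance"
into "for Lebesgue almost every `r`". -/
theorem volume_restrict_absolutelyContinuous :
    volume.restrict (Icc p.rMin p.rMax) ≪ M.servingLaw := by
  rw [M.servingLaw_eq]
  have hsub : Icc p.rMin p.rMax ⊆ Icc p.rMin p.rFar :=
    Icc_subset_Icc_right p.rMax_lt_rFar.le
  have h1 : volume.restrict (Icc p.rMin p.rMax) ≪ ((volume.restrict (Icc p.rMin p.rMax)).withDensity
      fun r => ENNReal.ofReal (p.servingDensity r)) := by
    refine withDensity_absolutelyContinuous'
      p.continuous_servingDensity.measurable.ennreal_ofReal.aemeasurable ?_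
    filter_upwards [ae_restrict_mem measurableSet_Icc] with r hr
    exact (ENNReal.ofReal_pos.2 (p.servingDensity_pos hr)).ne'
  refine h1.trans (Measure.absolutelyContinuous_of_le ?_)
  refine Measure.le_iff.2 fun B hB => ?_
  rw [withDensity_apply _ hB, withDensity_apply _ hB]
  exact lintegral_mono' (Measure.restrict_mono le_rfl (Measure.restrict_mono hsub le_rfl)) le_rfl

/-! ### The interference has no atoms -/

/-- With all gains and all other distances frozen, the sum is injective in the distance of `j`, and
the right side does not move since `i ≠ j`. The equation thus fixes that distance to at most one
value, a null event. No regularity of the gain law is needed, only positivity, which is therefore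
part of the event. -/
theorem measure_sum_interference_eq (i j : Fin p.N) (S : Finset (Fin p.N)) (hj : j ∈ S)
    (hi : i ∉ S) {a : ℝ → ℝ} (ha : Measurable a) :
    P {w | 0 < M.gain j w ∧ 0 < M.R j w ∧
      ∑ k ∈ S, p.pI * M.gain k w * M.R k w ^ (-p.α) = a (M.R i w)} = 0 := by
  have hind : IndepFun (fun w i => M.R i w) (fun w i => M.gain i w) P :=
    M.distances_indep.comp measurable_id measurable_fst
  have hR : Measurable fun w i => M.R i w := measurable_pi_lambda _ M.measurable_R
  have hg : Measurable fun w i => M.gain i w := measurable_pi_lambda _ M.gain_meas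
  have hmap := (indepFun_iff_map_prod_eq_prod_map_map hR.aemeasurable hg.aemeasurable).1 hind
  let E : Set ((Fin p.N → ℝ) × (Fin p.N → ℝ)) := {q | 0 < q.2 j ∧ 0 < q.1 j ∧
    ∑ k ∈ S, p.pI * q.2 k * q.1 k ^ (-p.α) = a (q.1 i)}
  have hE : MeasurableSet E := by
    simp only [E, ofPred_and]
    refine (measurableSet_lt (by fun_prop) (by fun_prop)).inter
      ((measurableSet_lt (by fun_prop) (by fun_prop)).inter (measurableSet_eq_fun ?_ ?_))
    · refine Finset.measurable_sum _ fun k _ => ?_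
      have h1 : Measurable fun q : (Fin p.N → ℝ) × (Fin p.N → ℝ) => q.1 k := by fun_prop
      have h2 : Measurable fun q : (Fin p.N → ℝ) × (Fin p.N → ℝ) => q.2 k := by fun_prop
      exact (h2.const_mul _).mul (h1.pow_const _)
    · exact ha.comp (by fun_prop)
  have h1 : P {w | 0 < M.gain j w ∧ 0 < M.R j w ∧
      ∑ k ∈ S, p.pI * M.gain k w * M.R k w ^ (-p.α) = a (M.R i w)} =
      P.map (fun w => ((fun i => M.R i w), fun i => M.gain i w)) E :=
    (Measure.map_apply (hR.prodMk hg) hE).symm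
  have : IsProbabilityMeasure (P.map fun w i => M.gain i w) :=
    Measure.isProbabilityMeasure_map hg.aemeasurable
  rw [h1, hmap, M.map_distances, Measure.prod_apply_symm hE]
  rw [lintegral_eq_zero_of_ae_eq_zero]
  refine ae_of_all _ fun g => ?_
  refine pi_null_of_update p.distLaw (measurable_prodMk_right hE) j fun x => ?_
  have hij : i ≠ j := fun h => hi (h ▸ hj)
  refine Set.Subsingleton.measure_zero (fun s hs t ht => ?_) _
  have key : ∀ s, Function.update x j s ∈ (fun x => (x, g)) ⁻¹' E → 0 < g j ∧ 0 < s ∧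
      p.pI * g j * s ^ (-p.α) + ∑ k ∈ S.erase j, p.pI * g k * x k ^ (-p.α) = a (x i) := by
    rintro s ⟨h1, h2, h3⟩
    simp only [Function.update_self] at h1 h2
    refine ⟨h1, h2, ?_⟩
    rw [← Finset.add_sum_erase S _ hj] at h3
    simp only [Function.update_self, Function.update_of_ne hij] at h3
    rw [← h3]
    congr 1
    refine Finset.sum_congr rfl fun k hk => ?_
    rw [Function.update_of_ne (Finset.ne_of_mem_erase hk)]
  obtain ⟨hg0, hs0, hs1⟩ := key s hs
  obtain ⟨-, ht0, ht1⟩ := key t ht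
  have hpI := p.pI_pos
  have : s ^ (-p.α) = t ^ (-p.α) := by
    have hne : p.pI * g j ≠ 0 := by positivity
    refine mul_left_cancel₀ hne ?_
    linarith
  exact Real.rpow_left_injOn (neg_ne_zero.2 p.α_pos.ne') hs0.le ht0.le this

/-- The serving satellite and the interfering set are random but take finitely many values, so the
null events for fixed `i`, `j`, `S` suffice. -/
theorem ae_interference_ne {a : ℝ → ℝ} (ha : Measurable a) :
    ∀ᵐ w ∂P, 0 < M.NI w → M.I w ≠ a (M.R0 w) := by
  have hnull : ∀ᵐ w ∂P, ∀ i j, ∀ S : Finset (Fin p.N), j ∈ S → i ∉ S →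
      ¬ (0 < M.gain j w ∧ 0 < M.R j w ∧
        ∑ k ∈ S, p.pI * M.gain k w * M.R k w ^ (-p.α) = a (M.R i w)) := by
    refine ae_all_iff.2 fun i => ae_all_iff.2 fun j => ae_all_iff.2 fun S => ?_
    by_cases hj : j ∈ S
    · by_cases hi : i ∈ S
      · exact ae_of_all _ fun _ _ h => absurd hi h
      · filter_upwards [measure_eq_zero_iff_ae_notMem.1
          (M.measure_sum_interference_eq i j S hj hi ha)] with w hw _ _ using hw
    · exact ae_of_all _ fun _ h => absurd h hj
  filter_upwards [hnull, ae_all_iff.2 M.gain_pos, M.ae_R_mem] with w hw hg hR hNI hI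
  obtain ⟨j, hj⟩ := Finset.card_pos.1 hNI
  exact hw (M.serving w) j (M.interferers w) hj (fun h => (M.mem_interferers.1 h).1 rfl)
    ⟨hg j, p.rMin_pos.trans_le (hR j).1, hI⟩

end Network

end

end LEO

namespace LEO

noncomputable section

/-! ### Coverage as a threshold on the interference -/

namespace Params

variable (p : Params)

/-- The largest interference power at which the signal from distance `r` is still received. -/
def margin (T r : ℝ) : ℝ := p.pS / (T * r ^ p.α) - p.noise

theorem measurable_margin (T : ℝ) : Measurable (p.margin T) := by
  unfold margin
  exact (measurable_const.div ((measurable_id.pow_const _).const_mul T)).sub measurable_const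

variable {p}

theorem lt_sinr_iff {T r y : ℝ} (hT : 0 < T) (hr : 0 < r) (hy : 0 ≤ y) :
    T < p.pS * r ^ (-p.α) / (y + p.noise) ↔ y < p.margin T r := by
  have h1 := p.noise_pos
  have h2 := Real.rpow_pos_of_pos hr p.α
  rw [margin, Real.rpow_neg hr.le, lt_div_iff₀ (by positivity), lt_sub_iff_add_lt,
    lt_div_iff₀ (by positivity), ← div_eq_mul_inv, lt_div_iff₀ h2]
  constructor <;> intro h <;> linarith

theorem margin_pos_iff {T r : ℝ} (hT : 0 < T) (hr : 0 < r) :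
    0 < p.margin T r ↔ r < p.snrRange T := by
  have h1 := p.noise_pos
  have h2 := Real.rpow_pos_of_pos hr p.α
  have h3 := p.pS_pos
  rw [snrRange, one_div, Real.lt_rpow_inv_iff_of_pos hr.le (by positivity) p.α_pos, margin,
    sub_pos, lt_div_iff₀ (by positivity), lt_div_iff₀ (by positivity)]
  constructor <;> intro h <;> linarith

end Params

namespace Network

variable {p : Params} {Ω : Type*} [MeasurableSpace Ω] {P : Measure Ω} (M : Network p Ω P)

theorem lt_SNR_iff {T : ℝ} (hT : 0 < T) {w : Ω} (hw : 0 < M.R0 w) :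
    T < M.SNR w ↔ M.R0 w < p.snrRange T ∧ M.R0 w ≤ p.rMax := by
  by_cases h : M.R0 w ≤ p.rMax
  · have h1 := Params.lt_sinr_iff (p := p) hT hw le_rfl
    rw [zero_add, Params.margin_pos_iff hT hw] at h1
    rw [SNR, G0, if_pos h, mul_one, h1]
    simp [h]
  · simp [SNR, G0, h, hT.le]

theorem lt_SINR_iff {T : ℝ} (hT : 0 < T) {w : Ω} (hw : 0 < M.R0 w) (hI : 0 ≤ M.I w)
    (h : M.R0 w ≤ p.rMax) : T < M.SINR w ↔ M.I w < p.margin T (M.R0 w) := by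
  rw [SINR, G0, if_pos h, mul_one, Params.lt_sinr_iff hT hw hI]

theorem SINR_eq_SNR {w : Ω} (h : M.NI w = 0) : M.SINR w = M.SNR w := by
  rw [SINR, SNR, M.I_eq_zero h, zero_add]

theorem ae_R0_pos : ∀ᵐ w ∂P, 0 < M.R0 w := by
  filter_upwards [M.ae_R_mem] with w hw
  exact p.rMin_pos.trans_le (hw _).1

theorem measurable_state : Measurable fun w => (M.SINR w, M.I w, M.NI w) :=
  M.measurable_SINR.prodMk (M.measurable_I.prodMk M.measurable_NI)

variable [IsProbabilityMeasure P]

/-! ### The conditional distribution given the serving distance -/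

instance : IsMarkovKernel M.condKernel := by unfold condKernel; infer_instance

instance (r : ℝ) : IsFiniteMeasure (M.condLaw r) := by unfold condLaw; infer_instance

theorem measurableSet_interf : MeasurableSet {x : ℝ × ℝ × ℕ | 0 < x.2.2} :=
  measurableSet_lt measurable_const (by fun_prop)

theorem measurableSet_noInterf : MeasurableSet {x : ℝ × ℝ × ℕ | x.2.2 = 0} :=
  measurableSet_eq_fun (by fun_prop) measurable_const

theorem measurableSet_covered (T : ℝ) : MeasurableSet {x : ℝ × ℝ × ℕ | T < x.1} :=
  measurableSet_lt measurable_const measurable_fst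

theorem setLIntegral_condKernel {A : Set (ℝ × ℝ × ℕ)} (hA : MeasurableSet A) {B : Set ℝ}
    (hB : MeasurableSet B) : ∫⁻ r in B, M.condKernel r A ∂M.servingLaw =
      P {w | M.R0 w ∈ B ∧ (M.SINR w, M.I w, M.NI w) ∈ A} := by
  rw [servingLaw, setLIntegral_map hB (M.condKernel.measurable_coe hA) M.measurable_R0]
  exact setLIntegral_preimage_condDistrib M.measurable_R0 M.measurable_state.aemeasurable hA hB

theorem measureReal_state_mem {A : Set (ℝ × ℝ × ℕ)} (hA : MeasurableSet A) :
    P.real {w | (M.SINR w, M.I w, M.NI w) ∈ A} = ∫ r, (M.condKernel r).real A ∂M.servingLaw := by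
  have h := M.setLIntegral_condKernel hA MeasurableSet.univ
  simp only [Measure.restrict_univ, mem_univ, true_and] at h
  rw [measureReal_def, ← h, ← integral_toReal (M.condKernel.measurable_coe hA).aemeasurable
    (ae_of_all _ fun r => measure_lt_top _ _)]
  rfl

theorem ae_condKernel_of_ae {A : Set (ℝ × ℝ × ℝ × ℕ)} (hA : MeasurableSet A)
    (h : ∀ᵐ w ∂P, (M.R0 w, M.SINR w, M.I w, M.NI w) ∈ A) :
    ∀ᵐ r ∂M.servingLaw, ∀ᵐ x ∂M.condKernel r, (r, x) ∈ A := by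
  refine Measure.ae_ae_of_ae_compProd (p := fun q => q ∈ A) ?_
  rw [servingLaw, condKernel, compProd_map_condDistrib M.measurable_state.aemeasurable]
  exact (ae_map_iff (p := fun q => q ∈ A)
    (M.measurable_R0.prodMk M.measurable_state).aemeasurable hA).2 h

/-- Both sides have the same integral over every Borel set of serving distances, by disintegration
and `measure_R0_mem_NI_eq_zero`. -/
theorem ae_condKernel_noInterf :
    ∀ᵐ r ∂M.servingLaw, M.condKernel r {x | x.2.2 = 0} = ENNReal.ofReal (p.P0 r) := by
  refine ae_eq_of_forall_setLIntegral_eq_of_sigmaFinite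
    (M.condKernel.measurable_coe measurableSet_noInterf) p.measurable_P0.ennreal_ofReal
    fun B hB _ => ?_
  rw [M.setLIntegral_condKernel measurableSet_noInterf hB, ← M.measure_R0_mem_NI_eq_zero hB]
  rfl

theorem ae_noInterf_eq : ∀ᵐ r ∂M.servingLaw, M.noInterf r = p.P0 r := by
  filter_upwards [M.ae_condKernel_noInterf, M.ae_servingLaw_mem] with r h hr
  rw [noInterf, measureReal_def, h, ENNReal.toReal_ofReal (p.P0_nonneg hr.1)]

theorem ae_measureReal_interf :
    ∀ᵐ r ∂M.servingLaw, (M.condKernel r).real {x | 0 < x.2.2} = 1 - p.P0 r := by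
  filter_upwards [M.ae_noInterf_eq] with r h
  have hc : {x : ℝ × ℝ × ℕ | 0 < x.2.2} = {x | x.2.2 = 0}ᶜ := by
    ext x; simp [Nat.pos_iff_ne_zero]
  rw [hc, probReal_compl_eq_one_sub measurableSet_noInterf, ← h, noInterf]

/-- Gathers the almost sure facts about the network into one measurable event, so that they can be
used under the conditional law for a fixed `r`: those required by the inversion formula, and the
meaning of coverage in both cases. -/
theorem ae_condKernel_state {T : ℝ} (hT : 0 < T) :
    ∀ᵐ r ∂M.servingLaw, ∀ᵐ x ∂M.condKernel r,
      (0 < x.2.2 → 0 < x.2.1 ∧ x.2.1 ≠ p.margin T r ∧ (T < x.1 ↔ x.2.1 < p.margin T r)) ∧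
      (x.2.2 = 0 → (T < x.1 ↔ r < p.snrRange T ∧ r ≤ p.rMax)) := by
  let A : Set (ℝ × ℝ × ℝ × ℕ) := {q |
    (0 < q.2.2.2 → 0 < q.2.2.1 ∧ q.2.2.1 ≠ p.margin T q.1 ∧
      (T < q.2.1 ↔ q.2.2.1 < p.margin T q.1)) ∧
    (q.2.2.2 = 0 → (T < q.2.1 ↔ q.1 < p.snrRange T ∧ q.1 ≤ p.rMax))}
  have hm : Measurable fun q : ℝ × ℝ × ℝ × ℕ => p.margin T q.1 :=
    (p.measurable_margin T).comp measurable_fst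
  have hlt : ∀ {f g : ℝ × ℝ × ℝ × ℕ → ℝ}, Measurable f → Measurable g →
      Measurable fun q => f q < g q := fun hf hg =>
    measurableSet_setOfPred.1 (measurableSet_lt hf hg)
  have hle : ∀ {f g : ℝ × ℝ × ℝ × ℕ → ℝ}, Measurable f → Measurable g →
      Measurable fun q => f q ≤ g q := fun hf hg =>
    measurableSet_setOfPred.1 (measurableSet_le hf hg)
  have heq : Measurable fun q : ℝ × ℝ × ℝ × ℕ => q.2.2.1 = p.margin T q.1 :=
    measurableSet_setOfPred.1 (measurableSet_eq_fun (by fun_prop) hm)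
  have hn : Measurable fun q : ℝ × ℝ × ℝ × ℕ => 0 < q.2.2.2 :=
    measurableSet_setOfPred.1 (measurableSet_lt measurable_const (by fun_prop))
  have hn0 : Measurable fun q : ℝ × ℝ × ℝ × ℕ => q.2.2.2 = 0 :=
    measurableSet_setOfPred.1 (measurableSet_eq_fun (by fun_prop) measurable_const)
  have hA : MeasurableSet A := by
    refine measurableSet_setOfPred.2 (Measurable.and (hn.imp ?_) (hn0.imp ?_))
    · exact (hlt measurable_const (by fun_prop)).and
        (heq.not.and ((hlt measurable_const (by fun_prop)).iff (hlt (by fun_prop) hm)))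
    · exact (hlt measurable_const (by fun_prop)).iff
        ((hlt (by fun_prop) measurable_const).and (hle (by fun_prop) measurable_const))
  refine M.ae_condKernel_of_ae hA ?_
  filter_upwards [M.ae_R0_pos, M.ae_interference_pos,
    M.ae_interference_ne (p.measurable_margin T)] with w hR hI hne
  refine ⟨fun h => ⟨hI h, hne h, ?_⟩, fun h => ?_⟩
  · exact M.lt_SINR_iff hT hR (hI h).le (M.R0_le_rMax_of_NI_pos h)
  · simp only at h ⊢
    rw [M.SINR_eq_SNR h]
    exact M.lt_SNR_iff hT hR

theorem hasPVIntegral_freqIntegrand {T : ℝ} (hT : 0 < T) :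
    ∀ᵐ r ∂M.servingLaw, HasPVIntegral (M.freqIntegrand T r)
      (2 * Real.pi * M.condCoverageInterf T r : ℝ) := by
  filter_upwards [M.ae_condKernel_state hT] with r hr
  have hr' := (cond_absolutelyContinuous (μ := M.condKernel r)
    (s := {x : ℝ × ℝ × ℕ | 0 < x.2.2})).ae_le hr
  have hpos := ae_cond_mem (μ := M.condKernel r) measurableSet_interf
  have hY : Measurable fun x : ℝ × ℝ × ℕ => x.2.1 := by fun_prop
  have h := hasPVIntegral_inversion (M.condLaw r) hY (a := p.margin T r)
    (by filter_upwards [hr', hpos] with x h1 h2 using (h1.1 h2).1)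
    (by filter_upwards [hr', hpos] with x h1 h2 using (h1.1 h2).2.1)
  have hset : (M.condLaw r).real {x | x.2.1 < p.margin T r} = M.condCoverageInterf T r := by
    refine measureReal_congr ?_
    filter_upwards [hr', hpos] with x h1 h2
    exact propext (h1.1 h2).2.2.symm
  rw [hset] at h
  exact h

/-- The product rule for conditional probability. If interference has conditional probability zero,
`condLaw` is the zero measure and both sides vanish. -/
theorem ae_measureReal_covered_interf (T : ℝ) :
    ∀ᵐ r ∂M.servingLaw, (M.condKernel r).real {x | T < x.1 ∧ 0 < x.2.2} =
      (1 - p.P0 r) * M.condCoverageInterf T r := by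
  filter_upwards [M.ae_measureReal_interf] with r hr
  have h := cond_mul_eq_inter measurableSet_interf {x : ℝ × ℝ × ℕ | T < x.1} (M.condKernel r)
  rw [← hr, condCoverageInterf, condLaw, measureReal_def, measureReal_def, measureReal_def,
    mul_comm, ← ENNReal.toReal_mul, h]
  congr 2
  ext x; simp [and_comm]

theorem ae_condCoverage_eq {T : ℝ} (hT : 0 < T) :
    ∀ᵐ r ∂M.servingLaw, r ≤ p.rMax → M.condCoverage T r =
      p.P0 r * (if r < p.snrRange T then 1 else 0) +
        (1 - p.P0 r) * M.condCoverageInterf T r := by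
  filter_upwards [M.ae_measureReal_covered_interf T, M.ae_condKernel_state hT,
    M.ae_noInterf_eq] with r h1 h2 h3 hr
  have hsplit := measureReal_inter_add_sdiff (μ := M.condKernel r)
    (s := {x : ℝ × ℝ × ℕ | T < x.1}) measurableSet_noInterf
  rw [condCoverage, ← hsplit, ← h1]
  congr 1
  · by_cases hc : r < p.snrRange T
    · rw [if_pos hc, mul_one, ← h3, noInterf]
      refine measureReal_congr ?_
      filter_upwards [h2] with x hx
      refine propext ?_
      change (T < x.1 ∧ x.2.2 = 0) ↔ x.2.2 = 0
      exact ⟨fun h => h.2, fun h => ⟨(hx.2 h).2 ⟨hc, hr⟩, h⟩⟩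
    · rw [if_neg hc, mul_zero, measureReal_def, measure_eq_zero_iff_ae_notMem.2, ENNReal.toReal_zero]
      filter_upwards [h2] with x hx h
      exact hc ((hx.2 h.2).1 h.1).1
  · congr 1
    ext x; simp [Nat.pos_iff_ne_zero]

theorem measurable_condCoverageInterf (T : ℝ) : Measurable (M.condCoverageInterf T) := by
  have h : M.condCoverageInterf T = fun r => ((M.condKernel r {x | 0 < x.2.2})⁻¹ *
      M.condKernel r ({x | 0 < x.2.2} ∩ {x | T < x.1})).toReal := by
    funext r
    rw [condCoverageInterf, condLaw, measureReal_def, cond_apply measurableSet_interf]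
  rw [h]
  exact ((M.condKernel.measurable_coe measurableSet_interf).inv.mul (M.condKernel.measurable_coe
    (measurableSet_interf.inter (measurableSet_covered T)))).ennreal_toReal

theorem condCoverageInterf_nonneg (T r : ℝ) : 0 ≤ M.condCoverageInterf T r := measureReal_nonneg

theorem condCoverageInterf_le_one (T r : ℝ) : M.condCoverageInterf T r ≤ 1 := by
  rw [condCoverageInterf, condLaw, measureReal_def]
  exact ENNReal.toReal_le_of_le_ofReal zero_le_one (by rw [ENNReal.ofReal_one]; exact prob_le_one)

/-! ### Integrals against the law of the serving distance -/

theorem setIntegral_servingLaw (f : ℝ → ℝ) :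
    ∫ r in Iic p.rMax, f r ∂M.servingLaw =
      ∫ r in p.rMin..p.rMax, p.servingDensity r * f r := by
  rw [M.servingLaw_eq, setIntegral_withDensity_eq_setIntegral_toReal_smul
    p.continuous_servingDensity.measurable.ennreal_ofReal
    (ae_of_all _ fun _ => ENNReal.ofReal_lt_top) _ measurableSet_Iic,
    Measure.restrict_restrict measurableSet_Iic, intervalIntegral.integral_of_le p.rMin_le_rMax]
  have hset : Iic p.rMax ∩ Icc p.rMin p.rFar = Icc p.rMin p.rMax := by
    ext x; simp only [mem_inter_iff, mem_Iic, mem_Icc]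
    exact ⟨fun h => ⟨h.2.1, h.1⟩, fun h => ⟨h.2, h.1, h.2.trans p.rMax_lt_rFar.le⟩⟩
  rw [hset, Measure.restrict_congr_set Ioc_ae_eq_Icc.symm]
  refine setIntegral_congr_fun measurableSet_Ioc fun r hr => ?_
  rw [ENNReal.toReal_ofReal (p.servingDensity_pos ⟨hr.1.le, hr.2⟩).le, smul_eq_mul]

/-- The factor `2π` is the one relating the frequency integral to a probability; it turns the
constant `2` of the serving density into `4π`. -/
theorem setIntegral_servingLaw_complex (f : ℝ → ℝ) :
    ((∫ r in Iic p.rMax, f r ∂M.servingLaw : ℝ) : ℂ) =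
      p.N / (4 * Real.pi * p.rE * (p.rE + p.rMin)) *
        ∫ r in p.rMin..p.rMax, ((2 * Real.pi * f r : ℝ) : ℂ) * p.tail r ^ (p.N - 1) * r := by
  have h1 := p.rE_pos
  have h2 := p.rMin_pos
  have h3 := Real.pi_pos
  have hpt : ∀ r : ℝ, ((2 * Real.pi * f r : ℝ) : ℂ) * p.tail r ^ (p.N - 1) * r =
      ((2 * Real.pi * f r * p.tail r ^ (p.N - 1) * r : ℝ) : ℂ) := by
    intro r; push_cast; rfl
  simp_rw [hpt]
  have hc : (p.N : ℂ) / (4 * Real.pi * p.rE * (p.rE + p.rMin)) =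
      ((p.N / (4 * Real.pi * p.rE * (p.rE + p.rMin)) : ℝ) : ℂ) := by push_cast; rfl
  rw [M.setIntegral_servingLaw, intervalIntegral.integral_ofReal, hc, ← Complex.ofReal_mul,
    ← intervalIntegral.integral_const_mul]
  congr 1
  refine intervalIntegral.integral_congr fun r _ => ?_
  rw [Params.servingDensity]
  field_simp
  ring

theorem intervalIntegrable_of_abs_le_one {f : ℝ → ℝ} (hf : Measurable f)
    (hb : ∀ r, p.rMin ≤ r → |f r| ≤ 1) :
    IntervalIntegrable (fun r => ((2 * Real.pi * f r : ℝ) : ℂ) * p.tail r ^ (p.N - 1) * r)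
      volume p.rMin p.rMax := by
  have htail := p.continuous_tail
  have hg : Continuous fun r => 2 * Real.pi * p.tail r ^ (p.N - 1) * r := by fun_prop
  refine (hg.intervalIntegrable p.rMin p.rMax).mono_fun ?_ ?_
  · have : Measurable fun r => p.tail r := htail.measurable
    exact Measurable.aestronglyMeasurable (by fun_prop)
  · rw [uIoc_of_le p.rMin_le_rMax]
    filter_upwards [ae_restrict_mem measurableSet_Ioc] with r hr
    have hbr := hb r hr.1.le
    simp only [norm_mul, norm_pow, Complex.norm_real, Real.norm_eq_abs]
    refine mul_le_mul_of_nonneg_right (mul_le_mul_of_nonneg_right ?_ (by positivity))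
      (by positivity)
    exact mul_le_of_le_one_right (by positivity) hbr

/-! ### Coverage without and with interference -/

/-- The strict inequality at `snrRange` becomes a closed half-line because the serving distance has
no atoms. -/
theorem ae_lt_SNR_iff {T : ℝ} (hT : 0 < T) :
    ∀ᵐ w ∂P, T < M.SNR w ↔ M.R0 w ∈ Iic (min (p.snrRange T) p.rMax) := by
  have hne : ∀ᵐ w ∂P, M.R0 w ≠ p.snrRange T := by
    refine ae_of_ae_map M.measurable_R0.aemeasurable (p := fun r => r ≠ p.snrRange T) ?_
    exact measure_eq_zero_iff_ae_notMem.1 (measure_singleton (μ := M.servingLaw) (p.snrRange T))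
  filter_upwards [M.ae_R0_pos, hne] with w hw hne
  rw [M.lt_SNR_iff hT hw, mem_Iic, le_min_iff, hne.le_iff_lt]

theorem measureReal_lt_SNR {T : ℝ} (hT : 0 < T) :
    P.real {w | T < M.SNR w} = cdf M.servingLaw (min (p.snrRange T) p.rMax) := by
  rw [cdf_eq_real, servingLaw, map_measureReal_apply M.measurable_R0 measurableSet_Iic]
  refine measureReal_congr ?_
  filter_upwards [M.ae_lt_SNR_iff hT] with w hw using propext hw

theorem measureReal_lt_SNR_noInterf {T : ℝ} (hT : 0 < T) :
    P.real {w | T < M.SNR w ∧ M.NI w = 0} =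
      ∫ r in Iic (min (p.snrRange T) p.rMax), p.P0 r ∂M.servingLaw := by
  rw [integral_eq_lintegral_of_nonneg_ae (ae_restrict_of_ae (by
    filter_upwards [M.ae_servingLaw_mem] with r hr using p.P0_nonneg hr.1))
    p.measurable_P0.aestronglyMeasurable, ← M.measure_R0_mem_NI_eq_zero measurableSet_Iic,
    ← measureReal_def]
  refine measureReal_congr ?_
  filter_upwards [M.ae_lt_SNR_iff hT] with w hw
  exact propext (and_congr_left fun _ => hw)

theorem measureReal_lt_SINR_interf (T : ℝ) :
    P.real {w | T < M.SINR w ∧ 0 < M.NI w} =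
      ∫ r in Iic p.rMax, (1 - p.P0 r) * M.condCoverageInterf T r ∂M.servingLaw := by
  have hA : MeasurableSet {x : ℝ × ℝ × ℕ | T < x.1 ∧ 0 < x.2.2} := by
    rw [ofPred_and]
    exact (measurableSet_covered T).inter measurableSet_interf
  -- Restricting to the visible range loses nothing: beyond the horizon `P0` is `1` and the
  -- integrand vanishes.
  rw [setIntegral_eq_integral_of_forall_compl_eq_zero, ← integral_congr_ae
    (M.ae_measureReal_covered_interf T), ← M.measureReal_state_mem hA]
  · rfl
  · intro r hr
    rw [Params.P0, if_neg (show ¬ r ≤ p.rMax from hr), sub_self, zero_mul]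

theorem coverage_eq_add (T : ℝ) : M.coverage T =
    P.real {w | T < M.SNR w ∧ M.NI w = 0} + P.real {w | T < M.SINR w ∧ 0 < M.NI w} := by
  have hm : MeasurableSet {w | M.NI w = 0} :=
    measurableSet_eq_fun M.measurable_NI measurable_const
  rw [coverage, ← measureReal_inter_add_sdiff (μ := P) (s := {w | T < M.SINR w}) hm]
  congr 2
  · ext w
    exact and_congr_left fun h => by rw [mem_ofPred_eq, M.SINR_eq_SNR h]
  · ext w
    simp [Nat.pos_iff_ne_zero]

end Network

end

end LEO

/-! ### Assembly of the theorem -/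

theorem theorem2 {Ω : Type*} [MeasurableSpace Ω] (P : Measure Ω) [IsProbabilityMeasure P]
    (p : LEO.Params) (M : LEO.Network p Ω P) (T : ℝ) (hT : 0 < T) :
    -- `P₀` is the conditional probability of no interference given the serving distance
    (∀ᵐ r ∂M.servingLaw, M.noInterf r = p.P0 r) ∧
    -- the interference-free term
    P.real {w | T < M.SNR w} = cdf M.servingLaw (min (p.snrRange T) p.rMax) ∧
    P.real {w | T < M.SNR w ∧ M.NI w = 0} =
      ∫ r in Iic (min (p.snrRange T) p.rMax), p.P0 r ∂M.servingLaw ∧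
    ∃ J : ℝ → ℂ,
      -- `J r` is the integral over `ω`; it gives the coverage probability under interference
      (∀ᵐ r ∂(volume.restrict (Icc p.rMin p.rMax)),
        LEO.HasPVIntegral (M.freqIntegrand T r) (J r) ∧
        (M.condCoverageInterf T r : ℂ) = 1 / (2 * Real.pi) * J r ∧
        (M.condCoverage T r : ℂ) = p.P0 r * (if r < p.snrRange T then 1 else 0) +
          (1 - p.P0 r) * (1 / (2 * Real.pi) * J r)) ∧
      IntervalIntegrable (fun r => J r * p.tail r ^ (p.N - 1) * r) volume p.rMin p.rMax ∧
      IntervalIntegrable (fun r => (1 - p.P0 r) * J r * p.tail r ^ (p.N - 1) * r)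
        volume p.rMin p.rMax ∧
      -- the interference term, averaged over the serving distance
      ((∫ r in Iic p.rMax, M.condCoverageInterf T r ∂M.servingLaw : ℝ) : ℂ) =
        p.N / (4 * Real.pi * p.rE * (p.rE + p.rMin)) *
          ∫ r in p.rMin..p.rMax, J r * p.tail r ^ (p.N - 1) * r ∧
      (P.real {w | T < M.SINR w ∧ 0 < M.NI w} : ℂ) =
        p.N / (4 * Real.pi * p.rE * (p.rE + p.rMin)) *
          ∫ r in p.rMin..p.rMax, (1 - p.P0 r) * J r * p.tail r ^ (p.N - 1) * r ∧
      -- the coverage probability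
      (M.coverage T : ℂ) =
        ((∫ r in Iic (min (p.snrRange T) p.rMax), p.P0 r ∂M.servingLaw : ℝ) : ℂ) +
        p.N / (4 * Real.pi * p.rE * (p.rE + p.rMin)) *
          ∫ r in p.rMin..p.rMax, (1 - p.P0 r) * J r * p.tail r ^ (p.N - 1) * r := by

  -- Absorbs the weight `1 - P0` into `f`, so that the same lemmas treat the weighted and the
  -- unweighted integrals.
  have hJ : ∀ f : ℝ → ℝ, (fun r : ℝ => (1 - (p.P0 r : ℂ)) * ((2 * Real.pi * f r : ℝ) : ℂ) *
      p.tail r ^ (p.N - 1) * r) = fun r : ℝ => ((2 * Real.pi * ((1 - p.P0 r) * f r) : ℝ) : ℂ) *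
      p.tail r ^ (p.N - 1) * r := by
    intro f; funext r; push_cast; ring
  have hmeas := M.measurable_condCoverageInterf T
  have hle : ∀ r, |M.condCoverageInterf T r| ≤ 1 := fun r => by
    rw [abs_of_nonneg (M.condCoverageInterf_nonneg T r)]
    exact M.condCoverageInterf_le_one T r
  -- The witness for `J` is `2π` times the conditional coverage, defined for every `r`, measurable
  -- and bounded; that it is the frequency integral is shown for almost every `r`.
  refine ⟨M.ae_noInterf_eq, M.measureReal_lt_SNR hT, M.measureReal_lt_SNR_noInterf hT,
    fun r => (2 * Real.pi * M.condCoverageInterf T r : ℝ), ?_, ?_, ?_, ?_, ?_, ?_⟩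
  · have hac := M.volume_restrict_absolutelyContinuous
    filter_upwards [hac.ae_le (M.hasPVIntegral_freqIntegrand hT),
      hac.ae_le (M.ae_condCoverage_eq hT), ae_restrict_mem measurableSet_Icc] with r h1 h2 hr
    have hpi : (Real.pi : ℂ) ≠ 0 := Complex.ofReal_ne_zero.2 Real.pi_ne_zero
    have hcc : (M.condCoverageInterf T r : ℂ) =
        1 / (2 * Real.pi) * ((2 * Real.pi * M.condCoverageInterf T r : ℝ) : ℂ) := by
      push_cast; field_simp
    refine ⟨h1, hcc, ?_⟩
    rw [← hcc, h2 hr.2]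
    split_ifs <;> push_cast <;> rfl
  · exact LEO.Network.intervalIntegrable_of_abs_le_one hmeas fun r _ => hle r
  · rw [hJ]
    refine LEO.Network.intervalIntegrable_of_abs_le_one
      ((measurable_const.sub p.measurable_P0).mul hmeas) fun r hr => ?_
    rw [abs_mul, abs_of_nonneg (sub_nonneg.2 (p.P0_le_one hr))]
    exact mul_le_one₀ (by linarith [p.P0_nonneg hr]) (abs_nonneg _) (hle r)
  · exact M.setIntegral_servingLaw_complex _
  · rw [hJ, M.measureReal_lt_SINR_interf, M.setIntegral_servingLaw_complex]
  · rw [M.coverage_eq_add, Complex.ofReal_add, M.measureReal_lt_SNR_noInterf hT, hJ,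
      M.measureReal_lt_SINR_interf, M.setIntegral_servingLaw_complex]
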